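/- **Definitions.** Let $\|\cdot\|$ be a norm on $\mathbb{R}^2$ and, for $u\in\mathbb{R}^2$, put $\langle u\rangle=\min_{p\in\mathbb{Z}^2}\|u-p\|$. A *best approximation sequence* of $v\in\mathbb{R}^2$ is a sequence $(q_n,p_n)_{n\ge 0}$ in $\mathbb{N}\times\mathbb{Z}^2$ with $1=q_0<q_1<\cdots$, $q_{n}=\min\{q\ge 1:\langle qv\rangle<\langle q_{n-1}v\rangle\}$ for $n\ge1$, and $\langle q_nv\rangle=\|q_nv-p_n\|$ for $n\ge0$. Put $\beta_n(v)=\sqrt{q_{n+1}}\,(q_nv-p_n)$. The vector $v$ is *badly approximable* if $\inf_{T\ge1}\sqrt T\min_{1\le q\le T}\langle qv\rangle>0$. For real $\theta$ and $\delta>0$ let $\Omega(\theta,\delta)=\{(r\cos\beta,r\sin\beta): r\in\mathbb{R},\ \theta-\delta\le\beta\le\theta+\delta\}$. Real numbers $a,c>0$, $D\ge1$ are *ellipsoid parameters* for $\|\cdot\|$ if $\sqrt{au_1^2+cu_2^2}\le\|u\|\le D\sqrt{au_1^2+cu_2^2}$ for all $u\in\mathbb{R}^2$; they are the parameters of a *best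 ellipsoid norm* for $\|\cdot\|$ if, among all ellipsoid parameters, they maximise $\left(\frac{4ac}{4D^2-1}\right)^{1/4}$. **Theorem 1.** Let $\|\cdot\|$ be an arbitrary norm on $\mathbb{R}^2$. A best ellipsoid norm for $\|\cdot\|$ exists, and there is a constant $M_{\|\cdot\|}>0$, equal to $\left(\frac{4ac}{4D^2-1}\right)^{1/4}$ for the parameters $a,c,D$ of any best ellipsoid norm for $\|\cdot\|$, such that the following holds. Let $0\le\theta<2\pi$ and $\delta>0$; let $(I_n)_{n\ge0}$ be closed non-degenerate intervals with $I_n\subset[0,M_{\|\cdot\|}]$; let $m\ge1$ be an integer and let $(z_n)_{n\ge1}$ be a sequence in $\{0,\dots,m-1\}$ such that, with $z_0=1$ and $z_{-1}=z_{-2}=0$, for every $n\ge1$ there are $s,i\in\mathbb{Z}$ and a choice of sign with $z_n\equiv sz_{n-1}+iz_{n-2}\pm z_{n-3}\pmod m$. Then there are continuum many $v\in\mathbb{R}^2$ which are not badly approximable, which have a best approximation sequence, and for which every best approximation sequence $(q_n,p_n)_{n\ge0}$ satisfies: (A) $\|\beta_n(v)\|\in I_n$ for all $n\ge0$; (B)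 $\beta_n(v)\in\Omega(\theta,\delta)$ for all $n\ge0$, and $\beta_n(v)$ and $\beta_{n+1}(v)$ lie in opposite open quadrants for all $n\ge0$; (C) $q_n\equiv z_n\pmod m$ for all $n\ge1$; (D) $\{(q_{n-2},p_{n-2}),(q_{n-1},p_{n-1}),(q_n,p_n)\}$ is a basis of the lattice $\mathbb{Z}^3$ for all $n\ge2$. Moreover, the following are parameters of best ellipsoid norms, with the following values of $M_{\|\cdot\|}$: - Euclidean norm: $a=c=1$, $D=1$, $M_{\|\cdot\|}=\sqrt{2/\sqrt3}$; - maximum norm: $a=c=\frac12$, $D=\sqrt2$, $M_{\|\cdot\|}=7^{-1/4}$; - $p$-norm, $2<p<\infty$: $a=c=2^{2/p-1}$, $D=2^{1/2-1/p}$, $M_{\|\cdot\|}=8^{1/(2p)}\,(8-4^{1/p})^{-1/4}$; - $p$-norm, $1\le p<2$: $a=c=1$, $D=2^{1/p-1/2}$, $M_{\|\cdot\|}=\sqrt2\,(2^{1+2/p}-1)^{-1/4}$. -/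

import Mathlib

open scoped ENNReal Cardinal

noncomputable section

/-- The plane `ℝ²` as a bare vector space. A norm on it is a `Seminorm ℝ Plane` that vanishes only
at the origin. -/
abbrev Plane : Type := Fin 2 → ℝ

/-- The real point with the given integer coordinates. -/
def intPoint (p : Fin 2 → ℤ) : Plane := fun i => (p i : ℝ)

/-- `⟨u⟩ = min {‖u - p‖ : p ∈ ℤ²}`, the distance from `u` to the integer lattice
(for a norm the infimum is attained). -/
def latticeDist (N : Seminorm ℝ Plane) (u : Plane) : ℝ :=
  ⨅ p : Fin 2 → ℤ, N (u - intPoint p)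

/-- `(q n, p n)` is a sequence of best approximation vectors of `v` with respect to `N`. -/
structure IsBestApproxSeq (N : Seminorm ℝ Plane) (v : Plane)
    (q : ℕ → ℕ) (p : ℕ → Fin 2 → ℤ) : Prop where
  q_zero : q 0 = 1
  strictMono : StrictMono q
  isLeast : ∀ n, IsLeast
    {k : ℕ | 1 ≤ k ∧ latticeDist N ((k : ℝ) • v) < latticeDist N ((q n : ℝ) • v)} (q (n + 1))
  realises : ∀ n, latticeDist N ((q n : ℝ) • v) = N ((q n : ℝ) • v - intPoint (p n))

/-- The `n`-th long displacement vector `√q_{n+1} (q_n v - p_n)`. -/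
def longDisplacement (v : Plane) (q : ℕ → ℕ) (p : ℕ → Fin 2 → ℤ) (n : ℕ) : Plane :=
  Real.sqrt (q (n + 1)) • ((q n : ℝ) • v - intPoint (p n))

/-- `v` is badly approximable: `inf_{T ≥ 1} T^{1/2} min_{1 ≤ k ≤ T} ⟨k v⟩ > 0`. -/
def BadlyApproximable (N : Seminorm ℝ Plane) (v : Plane) : Prop :=
  0 < ⨅ T : {T : ℝ // 1 ≤ T}, Real.sqrt T.1 *
    ⨅ k : {k : ℕ // 1 ≤ k ∧ (k : ℝ) ≤ T.1}, latticeDist N ((k.1 : ℝ) • v)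

/-- The (two-sided) sector `Ω(θ, δ)`. -/
def sector (θ δ : ℝ) : Set Plane :=
  {u | ∃ r β : ℝ, θ - δ ≤ β ∧ β ≤ θ + δ ∧ u = ![r * Real.cos β, r * Real.sin β]}

/-- `x` and `y` lie in opposite open quadrants: both coordinates have strictly opposite signs. -/
def OppositeQuadrants (x y : Plane) : Prop := x 0 * y 0 < 0 ∧ x 1 * y 1 < 0

/-- The vector `(q, p) ∈ ℤ³`. -/
def approxVector (q : ℕ) (p : Fin 2 → ℤ) : Fin 3 → ℤ := ![(q : ℤ), p 0, p 1]

/-- `u ↦ √(a u₁² + c u₂²)`. -/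
def ellipsoidNorm (a c : ℝ) (u : Plane) : ℝ := Real.sqrt (a * u 0 ^ 2 + c * u 1 ^ 2)

/-- The value `(4ac / (4D² - 1))^{1/4}`. -/
def ellipsoidConst (a c D : ℝ) : ℝ := (4 * a * c / (4 * D ^ 2 - 1)) ^ (1 / 4 : ℝ)

/-- `√(a u₁² + c u₂²) ≤ ‖u‖ ≤ D √(a u₁² + c u₂²)` for all `u`, where `a, c > 0` and `D ≥ 1`. -/
structure IsEllipsoidNormFor (N : Seminorm ℝ Plane) (a c D : ℝ) : Prop where
  a_pos : 0 < a
  c_pos : 0 < c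
  one_le : 1 ≤ D
  lower : ∀ u, ellipsoidNorm a c u ≤ N u
  upper : ∀ u, N u ≤ D * ellipsoidNorm a c u

/-- `√(a u₁² + c u₂²)` is a best ellipsoid norm for `N` with parameters `a, c, D`: it maximises
`(4ac / (4D² - 1))^{1/4}`. -/
structure IsBestEllipsoidNormFor (N : Seminorm ℝ Plane) (a c D : ℝ) : Prop
    extends IsEllipsoidNormFor N a c D where
  maximal : ∀ a' c' D', IsEllipsoidNormFor N a' c' D' →
    ellipsoidConst a' c' D' ≤ ellipsoidConst a c D

/-- The `p`-norm on the plane, `1 ≤ p ≤ ∞` (the maximum norm for `p = ∞`). -/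
def pNorm (p : ℝ≥0∞) [Fact (1 ≤ p)] : Seminorm ℝ Plane :=
  (normSeminorm ℝ (PiLp p fun _ : Fin 2 => ℝ)).comp
    (WithLp.linearEquiv p ℝ (Fin 2 → ℝ)).symm.toLinearMap

/-- The residues `z 1, z 2, … ∈ {0, …, m - 1}` satisfy
`z n ∈ {s z (n-1) + i z (n-2) ± z (n-3) mod m : i, s ∈ ℤ}` for all `n ≥ 1`, where by convention
`z 0 = 1` and `z (-1) = z (-2) = 0`. -/
structure AdmissibleResidues (m : ℕ) (z : ℤ → ℤ) : Prop where
  zero : z 0 = 1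
  neg_one : z (-1) = 0
  neg_two : z (-2) = 0
  range : ∀ n, 1 ≤ n → 0 ≤ z n ∧ z n < m
  step : ∀ n, 1 ≤ n → ∃ s i : ℤ,
    z n ≡ s * z (n - 1) + i * z (n - 2) + z (n - 3) [ZMOD m] ∨
    z n ≡ s * z (n - 1) + i * z (n - 2) - z (n - 3) [ZMOD m]

end

section
open Filter Topology

/-! ### Arithmetic of the choice of the next denominator -/

/-! An integer vector `X = (q, p)` has the displacement `q v - p` from `v`. At the rational point
`foot C` the displacements form a planar lattice of covolume `1 / C 0`. The required `v` is a limit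
of feet of vectors produced by the recursion `X = s • C + i • B ± A`. This keeps three consecutive
vectors a basis of `ℤ³`, and fixing `s` and `i` modulo `m` prescribes the residue of the
denominator.

The remaining freedom in `s` and `i` does the rest (`exists_next_vector`). A large `i` makes the
displacement of `C` from `foot X` almost opposite in direction to that of `B` from `foot C`, so a
fixed open cone, with alternating sign, contains all displacements. Then `s` tunes `X 0` so that
`√(X 0) ‖disp C‖` falls in the prescribed interval and, at the same time, the displacement of `B`
projects onto that of `C` with a coefficient close to a half-integer. For such a nearly centred
lattice the displacement of `C` is shortest as soon as its scaled length `t` satisfies `3 t⁴ < 4 a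
c` (`lt_of_near_half`). Only the lower ellipsoid bound is used; since `D ≥ 1`, the constant `M`
satisfies `3 M⁴ ≤ 4 a c`.

At `foot X` itself `C` and `X - C` tie, because the displacement of `X` vanishes. All other
competitors are finitely many up to any bound, hence stay worse near `foot X` (`eventually_best`),
and the next step moves the point so that `C` wins the tie. Closed balls around the feet shrink the
choices to a point `v` whose best approximations are exactly the chosen vectors.

Denominators may be taken arbitrarily large. Fast growth excludes bad approximability, and two
different choices at each step give a binary tree (`exists_binary_tree`). Its branches yield
distinct `v`, because the best approximation sequence is unique.

A best ellipsoid norm exists by compactness. For the `p`-norms optimality follows from testing the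
bounds at `(1,0)`, `(0,1)` and `(1,1)`. -/

/-- One step of the progression changes `α Q / q` by `α m`, which is small, so half-integers are not
skipped. In the window, `q / α` allows for rounding up to the next integer and half of that for the
shift to a half-integer. -/
theorem exists_progression_near_half {q m : ℤ} (hq : 0 < q) (hm : 0 < m) (r : ℤ)
    {α β Q₁ Q₂ η : ℝ} (hα : 0 < α) (h₁ : α * m ≤ η) (h₂ : α * m ≤ 1 / 2)
    (h₃ : Q₁ + 3 / 2 * (q / α) ≤ Q₂) :
    ∃ j k : ℤ, Q₁ ≤ r + m * q * j ∧ (r + m * q * j : ℝ) ≤ Q₂ ∧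
      |α * (r + m * q * j) / q - β - k - 1 / 2| ≤ η := by
  have hq' : (0 : ℝ) < q := by exact_mod_cast hq
  have hm' : (0 : ℝ) < m := by exact_mod_cast hm
  set k : ℤ := ⌈α * Q₁ / q - β⌉ with hk
  -- `S` hits the half-integer exactly; `j` picks the last term of the progression not exceeding
  -- `S`.
  set S : ℝ := (k + 1 / 2 + β) * q / α with hS
  set j : ℤ := ⌊(S - r) / (m * q)⌋ with hj
  have hk1 : α * Q₁ / q - β ≤ k := Int.le_ceil _
  have hk2 : (k : ℝ) < α * Q₁ / q - β + 1 := Int.ceil_lt_add_one _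
  have hmq : (0 : ℝ) < m * q := by positivity
  have hj1 : (j : ℝ) * (m * q) ≤ S - r := (le_div_iff₀ hmq).1 (Int.floor_le _)
  have hj2 : S - r < (j + 1) * (m * q) := (div_lt_iff₀ hmq).1 (Int.lt_floor_add_one _)
  have hSe : α * S / q = k + 1 / 2 + β := by rw [hS]; field_simp
  set t : ℝ := α / q with ht
  have htp : 0 < t := by positivity
  have e1 : α * S / q = t * S := by rw [ht]; ring
  have e2 : α * Q₁ / q = t * Q₁ := by rw [ht]; ring
  have e3 : α * m = t * (m * q) := by rw [ht]; field_simp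
  have e4 : α * (r + m * q * j) / q = t * (r + m * q * j) := by rw [ht]; ring
  have e5 : t * (q / α) = 1 := by rw [ht]; field_simp
  rw [e2] at hk1 hk2
  rw [e1] at hSe
  rw [e3] at h₁ h₂
  refine ⟨j, k, ?_, ?_, ?_⟩
  · refine le_of_mul_le_mul_left ?_ htp
    nlinarith
  · refine le_of_mul_le_mul_left ?_ htp
    have := mul_le_mul_of_nonneg_left h₃ htp.le
    nlinarith
  · rw [e4, abs_le]
    constructor <;> nlinarith

/-- Up to scaling, the right side is a quadratic form of determinant `P` on the lattice, with `c`
counting the layers parallel to the vector of square length `x`. Layers `|c| ≥ 2` are far away by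
the size of `P`; in the layers `c = ±1` the offset is at least `κ`. As `κ` tends to `1/2` the
condition on `P` becomes the hexagonal bound `3 T² < 4 P`. -/
theorem lt_of_near_half {x T P κ lam : ℝ} (hx : 0 < x) (hxT : x ≤ T) (hκ0 : 0 ≤ κ)
    (hκ : κ ≤ 1 / 2) (hP : (1 - κ ^ 2) * T ^ 2 < P) {k : ℤ} (hlam : |lam - k - 1 / 2| ≤ 1 / 2 - κ)
    (b c : ℤ) (hc : c ≠ 0) : T < x * (c * lam - b) ^ 2 + c ^ 2 * P / x := by
  have hT : 0 < T := hx.trans_le hxT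
  have hκ2 : κ ^ 2 ≤ 1 / 4 := by nlinarith
  have hP0 : 0 < P := lt_of_le_of_lt (by have : 0 ≤ 1 - κ ^ 2 := by linarith
                                         positivity) hP
  suffices h : T * x < x ^ 2 * (c * lam - b) ^ 2 + c ^ 2 * P by
    have e : x * (c * lam - b) ^ 2 + c ^ 2 * P / x
        = (x ^ 2 * (c * lam - b) ^ 2 + c ^ 2 * P) / x := by field_simp
    rw [e, lt_div_iff₀ hx]
    exact h
  have hc2 : c ^ 2 = 1 ∨ 4 ≤ c ^ 2 := by
    rcases lt_trichotomy c 0 with h | h | h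
    · rcases eq_or_lt_of_le (show c ≤ -1 by omega) with h | h
      · left; rw [h]; rfl
      · right; nlinarith
    · exact absurd h hc
    · rcases eq_or_lt_of_le (show 1 ≤ c by omega) with h | h
      · left; rw [← h]; rfl
      · right; nlinarith
  rcases hc2 with h | h
  · have hcr : (c : ℝ) ^ 2 = 1 := by exact_mod_cast h
    have key : κ ^ 2 ≤ (c * lam - b) ^ 2 := by
      have h1 : (c * lam - b) ^ 2 = (lam - (c * b : ℤ)) ^ 2 := by
        push_cast
        linear_combination (lam ^ 2 - (b : ℝ) ^ 2) * hcr
      rw [h1]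
      rw [abs_le] at hlam
      rcases le_or_gt (c * b) k with h | h
      · have : ((c * b : ℤ) : ℝ) ≤ k := by exact_mod_cast h
        nlinarith
      · have : (k : ℝ) + 1 ≤ ((c * b : ℤ) : ℝ) := by exact_mod_cast h
        nlinarith
    rw [hcr, one_mul]
    have : x ^ 2 * κ ^ 2 ≤ x ^ 2 * (c * lam - b) ^ 2 := by gcongr
    -- Expanded, this says `T x ≤ (1 - κ²) T² + κ² x²`, and the first summand is below `P`.
    have h2 : 0 ≤ (T - x) * (T * (1 - κ ^ 2) - κ ^ 2 * x) := by
      apply mul_nonneg (by linarith)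
      nlinarith
    nlinarith
  · have hcr : (4 : ℝ) ≤ (c : ℝ) ^ 2 := by exact_mod_cast h
    have h3 : 4 * P ≤ (c : ℝ) ^ 2 * P := by gcongr
    have h4 : 0 ≤ x ^ 2 * (c * lam - b) ^ 2 := by positivity
    have h5 : 3 / 4 * T ^ 2 ≤ (1 - κ ^ 2) * T ^ 2 := by gcongr; linarith
    nlinarith

theorem exists_modEq_ge {m : ℕ} (hm : 0 < m) (i₀ : ℤ) (R : ℝ) :
    ∃ i : ℤ, i ≡ i₀ [ZMOD m] ∧ R ≤ i := by
  obtain ⟨k, hk⟩ := exists_nat_ge (R - i₀)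
  refine ⟨i₀ + m * k, ?_, ?_⟩
  · simp [Int.ModEq]
  · have : (1 : ℝ) ≤ m := by exact_mod_cast hm
    push_cast
    nlinarith [(Nat.cast_nonneg k : (0 : ℝ) ≤ k)]

/-! ### Displacements -/

/-- The displacement `q v - p` of an integer vector `X = (q, p)`. -/
noncomputable def disp (v : Plane) (X : Fin 3 → ℤ) : Plane := (X 0 : ℝ) • v - intPoint ![X 1, X 2]

/-- The rational point `p / q` of an integer vector `X = (q, p)`. -/
noncomputable def foot (X : Fin 3 → ℤ) : Plane := (X 0 : ℝ)⁻¹ • intPoint ![X 1, X 2]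

/-- The determinant of two vectors of the plane. -/
noncomputable def det2 (u v : Plane) : ℝ := u 0 * v 1 - u 1 * v 0

/-- The determinant of three integer vectors. -/
def det3 (A B C : Fin 3 → ℤ) : ℤ :=
  A 0 * (B 1 * C 2 - B 2 * C 1) - A 1 * (B 0 * C 2 - B 2 * C 0) + A 2 * (B 0 * C 1 - B 1 * C 0)

theorem disp_zero_apply (v : Plane) (X : Fin 3 → ℤ) : disp v X 0 = X 0 * v 0 - X 1 := by
  simp [disp, intPoint]

theorem disp_one_apply (v : Plane) (X : Fin 3 → ℤ) : disp v X 1 = X 0 * v 1 - X 2 := by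
  simp [disp, intPoint]

theorem plane_ext {u v : Plane} (h0 : u 0 = v 0) (h1 : u 1 = v 1) : u = v := by
  ext j; fin_cases j <;> assumption

theorem disp_add (v : Plane) (X Y : Fin 3 → ℤ) : disp v (X + Y) = disp v X + disp v Y := by
  apply plane_ext <;> simp only [disp_zero_apply, disp_one_apply, Pi.add_apply] <;> push_cast <;> ring

theorem disp_sub (v : Plane) (X Y : Fin 3 → ℤ) : disp v (X - Y) = disp v X - disp v Y := by
  apply plane_ext <;> simp only [disp_zero_apply, disp_one_apply, Pi.sub_apply] <;> push_cast <;> ring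

theorem disp_zsmul (v : Plane) (k : ℤ) (X : Fin 3 → ℤ) : disp v (k • X) = (k : ℝ) • disp v X := by
  apply plane_ext <;>
    simp only [disp_zero_apply, disp_one_apply, Pi.smul_apply, smul_eq_mul] <;> push_cast <;> ring

theorem disp_eq_add (v v' : Plane) (X : Fin 3 → ℤ) :
    disp v' X = disp v X + (X 0 : ℝ) • (v' - v) := by
  apply plane_ext <;>
    simp only [disp_zero_apply, disp_one_apply, Pi.smul_apply, smul_eq_mul, Pi.add_apply,
      Pi.sub_apply] <;> ring

theorem disp_foot_self {X : Fin 3 → ℤ} (hX : X 0 ≠ 0) : disp (foot X) X = 0 := by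
  have : (X 0 : ℝ) ≠ 0 := by exact_mod_cast hX
  simp [disp, foot, smul_smul, this]

theorem foot_sub {X : Fin 3 → ℤ} (hX : X 0 ≠ 0) (v : Plane) :
    foot X - v = -((X 0 : ℝ)⁻¹ • disp v X) := by
  have : (X 0 : ℝ) ≠ 0 := by exact_mod_cast hX
  simp [disp, foot, smul_sub, smul_smul, this]

/-- Since the displacement of `C` vanishes at its foot, a basis `A`, `B`, `C` projects to a planar
lattice of covolume `1 / C 0`. -/
theorem det2_disp_foot (A B : Fin 3 → ℤ) {C : Fin 3 → ℤ} (hC : C 0 ≠ 0) :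
    det2 (disp (foot C) B) (disp (foot C) A) * C 0 = - det3 A B C := by
  have : (C 0 : ℝ) ≠ 0 := by exact_mod_cast hC
  simp only [det2, disp_zero_apply, disp_one_apply, det3, foot, intPoint, Pi.smul_apply,
    smul_eq_mul]
  push_cast
  simp
  field_simp
  ring

/-! ### The next vector -/

theorem exists_norm_le_of_ellipsoid {N : Seminorm ℝ Plane} {a c : ℝ} (ha : 0 < a) (hc : 0 < c)
    (hQ : ∀ u, a * u 0 ^ 2 + c * u 1 ^ 2 ≤ N u ^ 2) : ∃ κ > 0, ∀ u, κ * ‖u‖ ≤ N u := by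
  have hmin : 0 < min a c := lt_min ha hc
  refine ⟨√(min a c), by positivity, fun u => ?_⟩
  rw [mul_comm, ← le_div_iff₀ (by positivity), pi_norm_le_iff_of_nonneg (by positivity)]
  intro j
  rw [le_div_iff₀ (by positivity)]
  refine abs_le_of_sq_le_sq' ?_ (apply_nonneg N u) |>.2
  rw [mul_pow, Real.sq_sqrt hmin.le, Real.norm_eq_abs, sq_abs]
  refine le_trans ?_ (hQ u)
  have h1 := min_le_left a c
  have h2 := min_le_right a c
  fin_cases j
  · simp only [Fin.zero_eta]
    nlinarith [sq_nonneg (u 0), sq_nonneg (u 1)]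
  · simp only [Fin.mk_one]
    nlinarith [sq_nonneg (u 0), sq_nonneg (u 1)]

-- Write `y` and `y'` for the displacements of `B` and `g • A` from `foot C`. The new vector has
-- displacement `w = i y + y'` there, whatever `s` is, so `i` fixes `w` and `s` only moves `X 0`.
-- From `foot X`, the vector `C` has displacement `-(q / X₀) w`.
set_option maxHeartbeats 2000000 in
theorem exists_next_vector (N : Seminorm ℝ Plane) {a c : ℝ} (ha : 0 < a) (hc : 0 < c)
    (hQ : ∀ u, a * u 0 ^ 2 + c * u 1 ^ 2 ≤ N u ^ 2) {K : Set Plane} (hKo : IsOpen K)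
    (hKs : ∀ r : ℝ, 0 < r → ∀ u ∈ K, r • u ∈ K) {A B C : Fin 3 → ℤ} (hdet : det3 A B C ^ 2 = 1)
    (hB : 0 ≤ B 0) (hBC : B 0 < C 0) (hyK : disp (foot C) B ∈ K) {m : ℕ} (hm : 0 < m)
    (s₀ i₀ : ℤ) {g : ℤ} (hg : g ^ 2 = 1) {t₁ t₂ : ℝ} (ht₁ : 0 < t₁) (ht : t₁ < t₂)
    (ht₂ : 3 * t₂ ^ 4 < 4 * (a * c)) (L : ℝ) {U : Set Plane} (hU : U ∈ 𝓝 (foot C)) :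
    ∃ s i : ℤ, s ≡ s₀ [ZMOD m] ∧ i ≡ i₀ [ZMOD m] ∧ ∃ X : Fin 3 → ℤ, X = s • C + i • B + g • A ∧
      L < X 0 ∧ 0 < X 0 ∧ foot X ∈ U ∧ t₁ ≤ √(X 0) * N (disp (foot X) C) ∧
      √(X 0) * N (disp (foot X) C) ≤ t₂ ∧ -disp (foot X) C ∈ K ∧
      N (disp (foot X) B) < N (disp (foot X) (C - B)) ∧
      ∀ b k d : ℤ, k ≠ 0 →
        N (disp (foot X) C) < N (disp (foot X) (d • X + b • C + k • B)) := by
  have hC : 0 < C 0 := hB.trans_lt hBC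
  obtain ⟨q, hq⟩ : ∃ q : ℝ, q = C 0 := ⟨_, rfl⟩
  have hq0 : 0 < q := by rw [hq]; exact_mod_cast hC
  obtain ⟨p, hp⟩ : ∃ p : ℝ, p = B 0 := ⟨_, rfl⟩
  have hp0 : 0 ≤ p := by rw [hp]; exact_mod_cast hB
  have hpq : p < q := by rw [hp, hq]; exact_mod_cast hBC
  set v := foot C with hv
  obtain ⟨y, hy⟩ : ∃ y, y = disp v B := ⟨_, rfl⟩
  obtain ⟨y', hy'⟩ : ∃ y', y' = (g : ℝ) • disp v A := ⟨_, rfl⟩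
  rw [← hy] at hyK
  have hgr : (g : ℝ) ^ 2 = 1 := by exact_mod_cast hg
  have hdd : det2 y y' ^ 2 * q ^ 2 = 1 := by
    have h1 := det2_disp_foot A B hC.ne'
    rw [← hv, ← hy, ← hq] at h1
    have h2 : det2 y y' = g * det2 y (disp v A) := by
      rw [hy']; simp only [det2, Pi.smul_apply, smul_eq_mul]; ring
    have h3 : ((det3 A B C : ℤ) : ℝ) ^ 2 = 1 := by exact_mod_cast hdet
    calc det2 y y' ^ 2 * q ^ 2 = g ^ 2 * (det2 y (disp v A) * q) ^ 2 := by rw [h2]; ring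
      _ = 1 := by rw [h1, hgr, neg_sq, h3, one_mul]
  obtain ⟨Qy, hQy⟩ : ∃ Qy : ℝ, Qy = a * y 0 ^ 2 + c * y 1 ^ 2 := ⟨_, rfl⟩
  have hyne : y 0 ≠ 0 ∨ y 1 ≠ 0 := by
    by_contra! h
    simp [det2, h.1, h.2] at hdd
  have hQy0 : 0 < Qy := by
    rw [hQy]
    rcases hyne with h | h
    · have : 0 < y 0 ^ 2 := by positivity
      positivity
    · have : 0 < y 1 ^ 2 := by positivity
      positivity
  have hNy : 0 < N y := by
    refine lt_of_le_of_ne (apply_nonneg N y) fun h => ?_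
    have := hQ y
    rw [← h, ← hQy] at this
    norm_num at this
    linarith
  have hNy' : 0 ≤ N y' := apply_nonneg N y'
  -- The strict inequality for `t₂` leaves room for an offset `κ` slightly below `1/2`; `η` is the
  -- tolerance gained.
  obtain ⟨κ, hκ4, hκ0, hκ⟩ : ∃ κ : ℝ, (1 - κ ^ 2) * t₂ ^ 4 < a * c ∧ 0 < κ ∧ κ < 1 / 2 := by
    have h1 : ∀ᶠ κ : ℝ in 𝓝[<] (1 / 2), (1 - κ ^ 2) * t₂ ^ 4 < a * c := by
      apply Filter.Eventually.filter_mono nhdsWithin_le_nhds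
      apply ContinuousAt.eventually_lt (by fun_prop) (by fun_prop)
      linarith
    have h2 : ∀ᶠ κ : ℝ in 𝓝[<] (1 / 2), κ ∈ Set.Ioo (0 : ℝ) (1 / 2) :=
      Ioo_mem_nhdsLT (by norm_num)
    obtain ⟨κ, h, h'⟩ := (h1.and h2).exists
    exact ⟨κ, h, h'.1, h'.2⟩
  set η : ℝ := 1 / 2 - κ with hη
  have hη0 : 0 < η := by linarith
  have hmr : (0 : ℝ) < m := by exact_mod_cast hm
  obtain ⟨δ, hδ⟩ : ∃ δ : ℝ, δ = (t₁ ^ 2)⁻¹ - (t₂ ^ 2)⁻¹ := ⟨_, rfl⟩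
  have ht₂0 : 0 < t₂ := ht₁.trans ht
  have hδ0 : 0 < δ := by
    rw [hδ, sub_pos]
    gcongr
  obtain ⟨κ₀, hκ₀, hκN⟩ := exists_norm_le_of_ellipsoid ha hc hQ
  obtain ⟨ε, hε, hεU⟩ := Metric.mem_nhds_iff.1 hU
  obtain ⟨e, he⟩ : ∃ e : ℝ, e = a * y 0 * y' 0 + c * y 1 * y' 1 := ⟨_, rfl⟩
  -- conditions valid for all large `x`
  have hlin : ∀ α β k : ℝ, 0 < α → ∀ᶠ x : ℝ in atTop, k < x * α + β := by
    intro α β k hα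
    filter_upwards [eventually_gt_atTop ((k - β) / α)] with x hx
    rw [div_lt_iff₀ hα] at hx
    linarith
  have hcone : ∀ᶠ x : ℝ in atTop, x • y + y' ∈ K := by
    have h1 : Tendsto (fun x : ℝ => y + x⁻¹ • y') atTop (𝓝 (y + (0 : ℝ) • y')) :=
      tendsto_const_nhds.add (tendsto_inv_atTop_zero.smul_const y')
    rw [zero_smul, add_zero] at h1
    filter_upwards [h1.eventually (hKo.mem_nhds hyK), eventually_gt_atTop 0] with x hx hx0
    have := hKs x hx0 _ hx
    rwa [smul_add, smul_smul, mul_inv_cancel₀ hx0.ne', one_smul] at this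
  -- The thresholds serve, in order: the cone; `x > 1`; `G > 0`; `α m ≤ η`; `α m ≤ 1/2`; the length
  -- of the window for `X₀`; domination of `y'` by `x y`; closeness of `foot X` to `foot C`; `p x ≤
  -- X₀`; and `X₀ > L`.
  obtain ⟨R, hR⟩ := Filter.eventually_atTop.1 (hcone.and ((eventually_gt_atTop (1 : ℝ)).and
    ((hlin Qy e 0 hQy0).and ((hlin Qy e (Qy * m / η) hQy0).and ((hlin Qy e (2 * Qy * m) hQy0).and
    ((hlin Qy e (3 / 2 / (q * δ)) hQy0).and ((hlin (N y / 2) (-N y') 0 (by positivity)).and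
    ((hlin (N y / 2) 0 (t₂ ^ 2 / (κ₀ * ε * q ^ 2)) (by positivity)).and
    ((hlin (q ^ 2 * N y ^ 2 / (4 * t₂ ^ 2)) 0 p (by positivity)).and
    (hlin (q ^ 2 * N y ^ 2 / (4 * t₂ ^ 2)) 0 (|L| + 1) (by positivity)))))))))))
  obtain ⟨i, him, hiR⟩ := exists_modEq_ge hm i₀ R
  obtain ⟨x, hx⟩ : ∃ x : ℝ, x = i := ⟨_, rfl⟩
  rw [← hx] at hiR
  obtain ⟨hwK, hx1, hG0, hG1, hG2, hG3, hN1, hN2, hN3, hN4⟩ := hR x hiR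
  clear hR hcone hlin
  obtain ⟨w, hw⟩ : ∃ w, w = x • y + y' := ⟨_, rfl⟩
  rw [← hw] at hwK
  obtain ⟨G, hG⟩ : ∃ G : ℝ, G = x * Qy + e := ⟨_, rfl⟩
  rw [← hG] at hG0 hG1 hG2 hG3
  obtain ⟨Qw, hQw⟩ : ∃ Qw : ℝ, Qw = a * w 0 ^ 2 + c * w 1 ^ 2 := ⟨_, rfl⟩
  have hQwN : Qw ≤ N w ^ 2 := hQw ▸ hQ w
  have hGw : G = a * y 0 * w 0 + c * y 1 * w 1 := by
    rw [hG, hw, hQy, he]; simp only [Pi.add_apply, Pi.smul_apply, smul_eq_mul]; ring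
  have hCS : G ^ 2 ≤ Qy * Qw := by
    have : Qy * Qw = G ^ 2 + a * c * (y 0 * w 1 - y 1 * w 0) ^ 2 := by
      rw [hGw, hQy, hQw]; ring
    rw [this]
    have : 0 ≤ a * c * (y 0 * w 1 - y 1 * w 0) ^ 2 := by positivity
    linarith
  have hQw0 : 0 < Qw := by
    have : 0 < Qy * Qw := lt_of_lt_of_le (by positivity) hCS
    exact (pos_iff_pos_of_mul_pos this).1 hQy0
  -- The coefficient of the projection of `y` onto `w` for the form `a u₀² + c u₁²`; it is of order
  -- `1 / x`.
  obtain ⟨α, hα⟩ : ∃ α : ℝ, α = G / Qw := ⟨_, rfl⟩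
  have hα0 : 0 < α := hα ▸ by positivity
  have hαG : α * G ≤ Qy := by
    rw [hα, div_mul_eq_mul_div, div_le_iff₀ hQw0, ← sq]; exact hCS
  have hwN : x * N y / 2 ≤ N w := by
    have h1 : N (x • y) ≤ N w + N y' := by
      have : x • y = w - y' := by rw [hw]; simp
      rw [this]; exact map_sub_le_add N w y'
    rw [map_smul_eq_mul, Real.norm_of_nonneg (by linarith)] at h1
    linarith
  have hNw0 : 0 < N w := lt_of_lt_of_le (by positivity) hwN
  have hαm1 : α * m ≤ η := by
    rw [div_lt_iff₀ hη0] at hG1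
    refine le_of_mul_le_mul_right ?_ hG0
    linarith [mul_le_mul_of_nonneg_right hαG hmr.le]
  have hαm2 : α * m ≤ 1 / 2 := by
    refine le_of_mul_le_mul_right ?_ hG0
    linarith [mul_le_mul_of_nonneg_right hαG hmr.le]
  have hwin : q ^ 2 * N w ^ 2 / t₂ ^ 2 + 3 / 2 * (q / α) ≤ q ^ 2 * N w ^ 2 / t₁ ^ 2 := by
    rw [div_lt_iff₀ (by positivity)] at hG3
    have h1 : q / α = q * Qw / G := by rw [hα]; field_simp
    have h2 : q ^ 2 * N w ^ 2 / t₁ ^ 2 - q ^ 2 * N w ^ 2 / t₂ ^ 2 = q ^ 2 * N w ^ 2 * δ := by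
      rw [hδ]; ring
    have h3 : 3 / 2 * (q / α) ≤ q ^ 2 * N w ^ 2 * δ := by
      rw [h1, ← mul_div_assoc, div_le_iff₀ hG0]
      calc 3 / 2 * (q * Qw) ≤ (G * (q * δ)) * (q * N w ^ 2) := by gcongr
        _ = _ := by ring
    linarith
  -- The endpoints of the window are the values of `X₀` at which `√X₀ N(disp C) = q N(w) / √X₀`
  -- equals `t₂` and `t₁`.
  obtain ⟨j, k, hQ1, hQ2, hlam⟩ := exists_progression_near_half (q := C 0) (m := m) hC
    (by exact_mod_cast hm) (s₀ * C 0 + i * B 0 + g * A 0) (α := α) (β := p / q)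
    (Q₁ := q ^ 2 * N w ^ 2 / t₂ ^ 2) (Q₂ := q ^ 2 * N w ^ 2 / t₁ ^ 2) (η := η) hα0
    (by exact_mod_cast hαm1) (by exact_mod_cast hαm2) (by rw [← hq]; exact hwin)
  refine ⟨s₀ + m * j, i, by simp [Int.ModEq], him, _, rfl, ?_⟩
  set X : Fin 3 → ℤ := (s₀ + m * j) • C + i • B + g • A with hX
  obtain ⟨X₀, hX₀⟩ : ∃ X₀ : ℝ, X₀ = X 0 := ⟨_, rfl⟩
  have hX₀' : X₀ = ((s₀ * C 0 + i * B 0 + g * A 0 : ℤ) : ℝ) + ((m : ℤ) : ℝ) * C 0 * j := by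
    rw [hX₀, hX]
    simp only [Pi.add_apply, Pi.smul_apply, smul_eq_mul]
    push_cast
    ring
  rw [← hX₀'] at hQ1 hQ2 hlam
  rw [← hq] at hlam
  rw [← hX₀]
  -- `X₀` is at least quadratic in `x`, so it beats every linear requirement.
  have hXlow : q ^ 2 * N y ^ 2 / (4 * t₂ ^ 2) * x ^ 2 ≤ X₀ := by
    refine le_trans ?_ hQ1
    calc q ^ 2 * N y ^ 2 / (4 * t₂ ^ 2) * x ^ 2 = q ^ 2 * (x * N y / 2) ^ 2 / t₂ ^ 2 := by ring
      _ ≤ _ := by gcongr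
  have hx0 : 0 < x := by linarith
  have hscale : ∀ κ : ℝ, κ < x * (q ^ 2 * N y ^ 2 / (4 * t₂ ^ 2)) + 0 → κ * x ≤ X₀ := by
    intro κ h
    refine le_trans ?_ hXlow
    rw [add_zero] at h
    calc κ * x ≤ x * (q ^ 2 * N y ^ 2 / (4 * t₂ ^ 2)) * x := by gcongr
      _ = _ := by ring
  have hpx : p * x ≤ X₀ := hscale _ hN3
  have hLX : |L| + 1 ≤ X₀ := (le_mul_of_one_le_right (by positivity) hx1.le).trans (hscale _ hN4)
  have hLx : L < X₀ := by linarith [le_abs_self L]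
  have hXpos : 0 < X₀ := by linarith [abs_nonneg L]
  have hy'x : N y' < x * N y := by
    have : 0 < x * N y := by positivity
    linarith
  have hXZ : 0 < X 0 := by rw [hX₀] at hXpos; exact_mod_cast hXpos
  have hdw : disp v X = w := by
    rw [hX, disp_add, disp_add, disp_zsmul, disp_zsmul, disp_zsmul, hv, disp_foot_self hC.ne',
      ← hv, ← hy, ← hy', smul_zero, zero_add, hw, hx]
  have hfoot : foot X - v = -(X₀⁻¹ • w) := by rw [foot_sub hXZ.ne' v, hdw, hX₀]
  have hfC : disp (foot X) C = -((q / X₀) • w) := by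
    rw [disp_eq_add v, hfoot, hv, disp_foot_self hC.ne', ← hq, zero_add, smul_neg, smul_smul]
    rfl
  have hfB : disp (foot X) B = y - (p / X₀) • w := by
    rw [disp_eq_add v, hfoot, ← hy, ← hp, smul_neg, smul_smul, sub_eq_add_neg]
    rfl
  have hNfC : N (disp (foot X) C) = q / X₀ * N w := by
    rw [hfC, map_neg_eq_map, map_smul_eq_mul, Real.norm_of_nonneg (by positivity)]
  have hsq : √X₀ ^ 2 = X₀ := Real.sq_sqrt hXpos.le
  have hT : (√X₀ * N (disp (foot X) C)) ^ 2 = q ^ 2 * N w ^ 2 / X₀ := by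
    rw [mul_pow, hsq, hNfC]; field_simp
  have hT1 : t₁ ≤ √X₀ * N (disp (foot X) C) := by
    refine le_of_sq_le_sq ?_ (by positivity)
    rw [hT, le_div_iff₀ hXpos]
    rw [le_div_iff₀ (by positivity)] at hQ2
    linarith
  have hT2 : √X₀ * N (disp (foot X) C) ≤ t₂ := by
    refine le_of_sq_le_sq ?_ ht₂0.le
    rw [hT, div_le_iff₀ hXpos]
    rw [div_le_iff₀ (by positivity)] at hQ1
    linarith
  refine ⟨hLx, hXZ, ?_, hT1, hT2, ?_, ?_, ?_⟩
  · apply hεU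
    rw [Metric.mem_ball, dist_eq_norm, hfoot, norm_neg, norm_smul, norm_inv,
      Real.norm_of_nonneg hXpos.le, inv_mul_lt_iff₀ hXpos]
    have h1 := hκN w
    rw [div_lt_iff₀ (by positivity)] at hN2
    rw [div_le_iff₀ (by positivity)] at hQ1
    have h2 : t₂ ^ 2 * (κ₀ * ‖w‖) < t₂ ^ 2 * (κ₀ * (X₀ * ε)) := by
      calc t₂ ^ 2 * (κ₀ * ‖w‖) ≤ t₂ ^ 2 * N w := by gcongr
        _ < (x * (N y / 2) + 0) * (κ₀ * ε * q ^ 2) * N w := by gcongr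
        _ ≤ N w * (κ₀ * ε * q ^ 2) * N w := by gcongr; linarith
        _ = κ₀ * ε * (q ^ 2 * N w ^ 2) := by ring
        _ ≤ κ₀ * ε * (X₀ * t₂ ^ 2) := by gcongr
        _ = _ := by ring
    exact lt_of_mul_lt_mul_left (lt_of_mul_lt_mul_left h2 (by positivity)) hκ₀.le
  · rw [hfC, neg_neg]
    exact hKs _ (by positivity) _ hwK
  -- The tie at `foot C`: moving against `w ≈ x y` does not lengthen the displacement of `B`, and
  -- strictly lengthens that of `C - B`, which was `-y`.
  · have h1 : N (disp (foot X) B) ≤ N y := by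
      have e1 : disp (foot X) B = (1 - p * x / X₀) • y - (p / X₀) • y' := by
        rw [hfB, hw, smul_add, smul_smul, sub_smul, one_smul, ← sub_sub]
        congr 3
        ring
      rw [e1]
      refine (map_sub_le_add N _ _).trans ?_
      have h3 : p * x / X₀ ≤ 1 := by rw [div_le_one hXpos]; exact hpx
      rw [map_smul_eq_mul, map_smul_eq_mul, Real.norm_of_nonneg (by linarith),
        Real.norm_of_nonneg (by positivity)]
      have h4 : p / X₀ * N y' ≤ p / X₀ * (x * N y) := by
        gcongr
      calc _ ≤ (1 - p * x / X₀) * N y + p / X₀ * (x * N y) := by gcongr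
        _ = N y := by ring
    refine h1.trans_lt ?_
    have e2 : disp (foot X) (C - B) = -((1 + (q - p) * x / X₀) • y - (-((q - p) / X₀)) • y') := by
      rw [disp_sub, hfC, hfB, hw]
      module
    rw [e2, map_neg_eq_map]
    have hqp : 0 < q - p := by linarith
    have h2 : N ((1 + (q - p) * x / X₀) • y)
        ≤ N ((1 + (q - p) * x / X₀) • y - (-((q - p) / X₀)) • y') + (q - p) / X₀ * N y' := by
      have h3 := map_add_le_add N ((1 + (q - p) * x / X₀) • y - (-((q - p) / X₀)) • y')
        ((-((q - p) / X₀)) • y')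
      rw [sub_add_cancel] at h3
      have h4 : N ((-((q - p) / X₀)) • y') = (q - p) / X₀ * N y' := by
        rw [map_smul_eq_mul, norm_neg, Real.norm_of_nonneg (by positivity)]
      rwa [h4] at h3
    rw [map_smul_eq_mul, Real.norm_of_nonneg (by positivity)] at h2
    have h5 : (q - p) / X₀ * N y' < (q - p) / X₀ * (x * N y) := by
      gcongr
    have h6 : (1 + (q - p) * x / X₀) * N y = N y + (q - p) / X₀ * (x * N y) := by ring
    linarith
  · intro b k' d hk'
    obtain ⟨u, hu⟩ : ∃ u, u = disp (foot X) (d • X + b • C + k' • B) := ⟨_, rfl⟩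
    obtain ⟨μ, hμ⟩ : ∃ μ : ℝ, μ = (b * q + k' * p) / X₀ := ⟨_, rfl⟩
    have hu' : u = (k' : ℝ) • y - μ • w := by
      rw [hu, disp_add, disp_add, disp_zsmul, disp_zsmul, disp_zsmul, disp_foot_self hXZ.ne', hfC,
        hfB, hμ]
      module
    rw [← hu]
    have hξ : 0 < q ^ 2 * Qw / X₀ := by positivity
    have key := lt_of_near_half (x := q ^ 2 * Qw / X₀) (T := q ^ 2 * N w ^ 2 / X₀) (κ := κ)
      (P := a * c) (lam := α * X₀ / q - p / q) hξ (by gcongr) hκ0.le hκ.le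
      (by
        refine lt_of_le_of_lt ?_ hκ4
        have : (q ^ 2 * N w ^ 2 / X₀) ^ 2 ≤ t₂ ^ 4 := by
          rw [← hT]
          calc ((√X₀ * N (disp (foot X) C)) ^ 2) ^ 2 ≤ (t₂ ^ 2) ^ 2 := by gcongr
            _ = t₂ ^ 4 := by ring
        have h' : 0 ≤ 1 - κ ^ 2 := by
          rw [sub_nonneg]; exact pow_le_one₀ hκ0.le (by linarith)
        gcongr) hlam b k' hk'
    -- Lagrange's identity splits `u` into its components along and across `w`; the cross part is
    -- known from the covolume.
    have hlag : (a * u 0 ^ 2 + c * u 1 ^ 2) * Qw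
        = (k' * G - μ * Qw) ^ 2 + a * c * (k' ^ 2 * det2 y y' ^ 2) := by
      have e1 : a * u 0 * w 0 + c * u 1 * w 1 = k' * G - μ * Qw := by
        rw [hu', hGw, hQw]; simp only [Pi.sub_apply, Pi.smul_apply, smul_eq_mul]; ring
      have e2 : u 0 * w 1 - u 1 * w 0 = k' * det2 y y' := by
        rw [hu', hw]
        simp only [Pi.sub_apply, Pi.smul_apply, Pi.add_apply, smul_eq_mul, det2]; ring
      rw [← e1, ← mul_pow, ← e2, hQw]
      ring
    have hform : q ^ 2 * Qw / X₀ * (k' * (α * X₀ / q - p / q) - b) ^ 2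
        + k' ^ 2 * (a * c) / (q ^ 2 * Qw / X₀) = X₀ * (a * u 0 ^ 2 + c * u 1 ^ 2) := by
      have e3 : a * u 0 ^ 2 + c * u 1 ^ 2
        = ((k' * G - μ * Qw) ^ 2 + a * c * (k' ^ 2 * det2 y y' ^ 2)) / Qw := by
        rw [← hlag]; field_simp
      have e4 : det2 y y' ^ 2 = 1 / q ^ 2 := by rw [← hdd]; field_simp
      rw [e3, e4, hμ, hα]
      field_simp
      ring
    rw [hform] at key
    refine lt_of_pow_lt_pow_left₀ 2 (apply_nonneg N u) (lt_of_lt_of_le ?_ (hQ u))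
    rw [hNfC]
    have : (q / X₀ * N w) ^ 2 = (q ^ 2 * N w ^ 2 / X₀) / X₀ := by field_simp
    rw [this, div_lt_iff₀ hXpos]
    linarith

/-! ### Best approximation is stable near rational points -/

theorem seminorm_plane_continuous (N : Seminorm ℝ Plane) : Continuous N := by
  obtain ⟨b, hb⟩ : ∃ b : ℝ, b = N ![1, 0] + N ![0, 1] := ⟨_, rfl⟩
  have hb0 : 0 ≤ b := by rw [hb]; positivity
  have hle : ∀ u, N u ≤ b * ‖u‖ := by
    intro u
    have hu : u = u 0 • ![1, 0] + u 1 • ![0, 1] := by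
      apply plane_ext <;> simp
    calc N u = N (u 0 • ![1, 0] + u 1 • ![0, 1]) := by rw [← hu]
      _ ≤ N (u 0 • ![1, 0]) + N (u 1 • ![0, 1]) := map_add_le_add N _ _
      _ = ‖u 0‖ * N ![1, 0] + ‖u 1‖ * N ![0, 1] := by rw [map_smul_eq_mul, map_smul_eq_mul]
      _ ≤ ‖u‖ * N ![1, 0] + ‖u‖ * N ![0, 1] := by
          gcongr
          · exact norm_le_pi_norm u 0
          · exact norm_le_pi_norm u 1
      _ = b * ‖u‖ := by rw [hb]; ring
  refine Seminorm.continuous_of_continuousAt_zero ?_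
  rw [ContinuousAt, map_zero]
  refine squeeze_zero (fun u => apply_nonneg N u) hle ?_
  have : Tendsto (fun u : Plane => b * ‖u‖) (𝓝 0) (𝓝 (b * ‖(0 : Plane)‖)) :=
    (continuous_const.mul continuous_norm).tendsto 0
  simpa using this

theorem continuous_seminorm_disp (N : Seminorm ℝ Plane) (X : Fin 3 → ℤ) :
    Continuous fun v => N (disp v X) := by
  refine (seminorm_plane_continuous N).comp ?_
  unfold disp
  fun_prop

/-- Among the integer vectors `(q, p)` with `1 ≤ q < C 0`, only `B` has the smallest displacement
from `v`, and the displacement of `C` is smaller. -/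
def IsStrictBest (N : Seminorm ℝ Plane) (B C : Fin 3 → ℤ) (v : Plane) : Prop :=
  (∀ Y : Fin 3 → ℤ, 1 ≤ Y 0 → Y 0 < C 0 → Y ≠ B → N (disp v B) < N (disp v Y)) ∧
    N (disp v C) < N (disp v B)

/-- Every integer vector is an integral combination of `A`, `B` and `C`. -/
def Spans (A B C : Fin 3 → ℤ) : Prop :=
  ∀ Y : Fin 3 → ℤ, ∃ b a d : ℤ, Y = d • C + b • B + a • A

theorem finite_setOf_disp_le {N : Seminorm ℝ Plane} {κ : ℝ} (hκ : 0 < κ)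
    (hN : ∀ u, κ * ‖u‖ ≤ N u) (v : Plane) (n : ℤ) (R : ℝ) :
    {Y : Fin 3 → ℤ | 1 ≤ Y 0 ∧ Y 0 < n ∧ N (disp v Y) ≤ R}.Finite := by
  obtain ⟨k, hk⟩ := exists_int_gt (R / κ + n * ‖v‖ + |n|)
  refine (Set.finite_Icc (fun _ : Fin 3 => -k) (fun _ => k)).subset ?_
  rintro Y ⟨h1, h2, h3⟩
  have h1' : (1 : ℝ) ≤ Y 0 := by exact_mod_cast h1
  have h2' : (Y 0 : ℝ) ≤ n := by exact_mod_cast h2.le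
  have hd : ‖disp v Y‖ ≤ R / κ := by rw [le_div_iff₀ hκ]; linarith [hN (disp v Y)]
  have hR : 0 ≤ R / κ := (norm_nonneg _).trans hd
  have hv := norm_nonneg v
  have hnv : (Y 0 : ℝ) * ‖v‖ ≤ n * ‖v‖ := by gcongr
  have hnv0 : 0 ≤ (n : ℝ) * ‖v‖ := le_trans (by positivity) hnv
  have hn : (n : ℝ) ≤ |(n : ℝ)| := le_abs_self _
  have key : ∀ j, |(Y j : ℝ)| ≤ k := by
    have aux : ∀ (x : ℝ) (j : Fin 2), ‖Y 0 * v j - x‖ ≤ R / κ → |x| ≤ k := by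
      intro x j h
      have h4 : ‖(Y 0 : ℝ) * v j‖ ≤ n * ‖v‖ := by
        rw [norm_mul, Real.norm_of_nonneg (by linarith : (0 : ℝ) ≤ Y 0)]
        exact le_trans (by gcongr; exact norm_le_pi_norm v j) hnv
      have h5 : ‖x‖ ≤ ‖(Y 0 : ℝ) * v j‖ + ‖Y 0 * v j - x‖ := by
        have := norm_sub_le ((Y 0 : ℝ) * v j) (Y 0 * v j - x)
        rwa [sub_sub_cancel] at this
      rw [Real.norm_eq_abs] at h5
      push_cast at hk
      linarith [abs_nonneg (n : ℝ)]
    intro j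
    fin_cases j
    · push_cast at hk
      simp only [Fin.zero_eta]
      rw [abs_of_nonneg (by linarith)]
      linarith
    · refine aux _ 0 ?_
      have h := (norm_le_pi_norm (disp v Y) 0).trans hd
      rw [disp_zero_apply] at h
      exact h
    · refine aux _ 1 ?_
      have h := (norm_le_pi_norm (disp v Y) 1).trans hd
      rw [disp_one_apply] at h
      exact h
  rw [Set.mem_Icc, Pi.le_def, Pi.le_def]
  constructor <;> intro j
  · exact_mod_cast (abs_le.1 (key j)).1
  · exact_mod_cast (abs_le.1 (key j)).2

/-- Off the plane of `B` and `C` the shortness hypothesis applies. On it the displacement is `b`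
times that of `B`, and for `|b| ≤ 1` the range of the denominator leaves only `B` and `C - B`. -/
theorem disp_foot_lt_of_shortest {N : Seminorm ℝ Plane} {A B C : Fin 3 → ℤ} (hspan : Spans A B C)
    (hB : 0 ≤ B 0) (hBC : B 0 < C 0) (hpos : 0 < N (disp (foot C) B))
    (hshort : ∀ b k d : ℤ, k ≠ 0 →
      N (disp (foot C) B) < N (disp (foot C) (d • C + b • B + k • A)))
    {Y : Fin 3 → ℤ} (h1 : 1 ≤ Y 0) (h2 : Y 0 < C 0) (hYB : Y ≠ B) (hYC : Y ≠ C - B) :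
    N (disp (foot C) B) < N (disp (foot C) Y) := by
  obtain ⟨b, a, d, rfl⟩ := hspan Y
  by_cases ha : a = 0
  swap
  · exact hshort b a d ha
  subst ha
  simp only [zero_smul, add_zero] at *
  simp only [Pi.add_apply, Pi.smul_apply, smul_eq_mul] at h1 h2
  have e : disp (foot C) (d • C + b • B) = (b : ℝ) • disp (foot C) B := by
    rw [disp_add, disp_zsmul, disp_zsmul, disp_foot_self (by omega), smul_zero, zero_add]
  rw [e, map_smul_eq_mul, Real.norm_eq_abs]
  have hb : 2 ≤ |b| := by
    by_contra! hb
    have hb' : b = -1 ∨ b = 0 ∨ b = 1 := by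
      rcases abs_lt.1 hb with ⟨h3, h4⟩; omega
    rcases hb' with rfl | rfl | rfl
    · rcases lt_trichotomy d 1 with h | h | h
      · nlinarith
      · subst h
        apply hYC
        simp [sub_eq_add_neg]
      · nlinarith
    · rcases le_or_gt d 0 with h | h <;> nlinarith
    · rcases lt_trichotomy d 0 with h | h | h
      · nlinarith
      · subst h
        apply hYB
        simp
      · nlinarith
  have : (2 : ℝ) ≤ |(b : ℝ)| := by exact_mod_cast hb
  nlinarith

/-- Only finitely many competitors come near the minimum, so there is a gap `γ` at `foot C`.
Denominators below `C 0` bound the effect of moving `v`, so the gap survives; the tie with `C - B`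
has no gap and is therefore left as a hypothesis. -/
theorem eventually_best {N : Seminorm ℝ Plane} {κ : ℝ} (hκ : 0 < κ) (hN : ∀ u, κ * ‖u‖ ≤ N u)
    {A B C : Fin 3 → ℤ} (hspan : Spans A B C)
    (hB : 0 ≤ B 0) (hBC : B 0 < C 0) (hpos : 0 < N (disp (foot C) B))
    (hshort : ∀ b k d : ℤ, k ≠ 0 →
      N (disp (foot C) B) < N (disp (foot C) (d • C + b • B + k • A))) :
    ∀ᶠ v in 𝓝 (foot C), N (disp v B) < N (disp v (C - B)) → IsStrictBest N B C v := by
  have hC : 0 < C 0 := by omega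
  have hCr : (0 : ℝ) < C 0 := by exact_mod_cast hC
  set y := disp (foot C) B with hy
  obtain ⟨γ, hγ0, hγ⟩ : ∃ γ : ℝ, 0 < γ ∧ ∀ Y : Fin 3 → ℤ, 1 ≤ Y 0 → Y 0 < C 0 → Y ≠ B →
      Y ≠ C - B → N y + γ ≤ N (disp (foot C) Y) := by
    have hfin := finite_setOf_disp_le hκ hN (foot C) (C 0) (N y + 1)
    have h1 : ∀ᶠ γ : ℝ in 𝓝[>] 0, ∀ Y ∈ {Y : Fin 3 → ℤ | 1 ≤ Y 0 ∧ Y 0 < C 0 ∧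
        N (disp (foot C) Y) ≤ N y + 1}, Y ≠ B → Y ≠ C - B → N y + γ < N (disp (foot C) Y) := by
      rw [Filter.eventually_all_finite hfin]
      rintro Y ⟨h1, h2, -⟩
      by_cases hYB : Y = B
      · exact Eventually.of_forall fun _ h => absurd hYB h
      by_cases hYC : Y = C - B
      · exact Eventually.of_forall fun _ _ h => absurd hYC h
      have h3 := disp_foot_lt_of_shortest hspan hB hBC hpos hshort h1 h2 hYB hYC
      have h4 : ∀ᶠ γ : ℝ in 𝓝[>] 0, γ ∈ Set.Ioo 0 (N (disp (foot C) Y) - N y) :=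
        Ioo_mem_nhdsGT (by linarith)
      filter_upwards [h4] with γ hγ _ _
      linarith [hγ.2]
    have h2 : ∀ᶠ γ : ℝ in 𝓝[>] 0, γ ∈ Set.Ioo (0 : ℝ) 1 := Ioo_mem_nhdsGT one_pos
    obtain ⟨γ, h, h'⟩ := (h1.and h2).exists
    refine ⟨γ, h'.1, fun Y hY1 hY2 hY3 hY4 => ?_⟩
    rcases le_or_gt (N (disp (foot C) Y)) (N y + 1) with h5 | h5
    · exact (h Y ⟨hY1, hY2, h5⟩ hY3 hY4).le
    · linarith [h'.2]
  have hnear : ∀ᶠ v in 𝓝 (foot C), N (v - foot C) < γ / (2 * C 0) := by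
    have hc : Continuous fun v => N (v - foot C) :=
      (seminorm_plane_continuous N).comp (continuous_id.sub continuous_const)
    refine hc.continuousAt.eventually_lt_const ?_
    simp only [sub_self, map_zero]
    positivity
  have hlast : ∀ᶠ v in 𝓝 (foot C), N (disp v C) < N (disp v B) := by
    refine ContinuousAt.eventually_lt (continuous_seminorm_disp N C).continuousAt
      (continuous_seminorm_disp N B).continuousAt ?_
    rw [disp_foot_self hC.ne', map_zero]
    exact hpos
  filter_upwards [hnear, hlast] with v hv hv' htie
  refine ⟨fun Y h1 h2 hYB => ?_, hv'⟩
  by_cases hYC : Y = C - B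
  · rw [hYC]; exact htie
  have hmove : ∀ Z : Fin 3 → ℤ, 0 ≤ Z 0 → Z 0 < C 0 →
      |N (disp v Z) - N (disp (foot C) Z)| < γ / 2 := by
    intro Z hZ0 hZ
    have hZ0' : (0 : ℝ) ≤ Z 0 := by exact_mod_cast hZ0
    have hZ' : (Z 0 : ℝ) ≤ C 0 := by exact_mod_cast hZ.le
    calc |N (disp v Z) - N (disp (foot C) Z)| ≤ N (disp v Z - disp (foot C) Z) :=
          abs_sub_map_le_sub N _ _
      _ = Z 0 * N (v - foot C) := by
          rw [disp_eq_add (foot C) v, add_sub_cancel_left, map_smul_eq_mul,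
            Real.norm_of_nonneg hZ0']
      _ ≤ C 0 * N (v - foot C) := by gcongr
      _ < C 0 * (γ / (2 * C 0)) := by gcongr
      _ = γ / 2 := by field_simp
  have h3 := abs_lt.1 (hmove B hB hBC)
  have h4 := abs_lt.1 (hmove Y (by omega) h2)
  have h5 := hγ Y h1 h2 hYB hYC
  linarith [h3.2, h4.1]

/-! ### From displacements to best approximation sequences -/

theorem disp_mk (v : Plane) (k : ℕ) (p : Fin 2 → ℤ) :
    disp v ![(k : ℤ), p 0, p 1] = (k : ℝ) • v - intPoint p := by
  apply plane_ext <;> simp [disp, intPoint]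

theorem latticeDist_nonneg (N : Seminorm ℝ Plane) (u : Plane) : 0 ≤ latticeDist N u :=
  Real.iInf_nonneg fun _ => apply_nonneg N _

theorem latticeDist_le (N : Seminorm ℝ Plane) (u : Plane) (p : Fin 2 → ℤ) :
    latticeDist N u ≤ N (u - intPoint p) :=
  ciInf_le ⟨0, by rintro _ ⟨p, rfl⟩; exact apply_nonneg N _⟩ p

/-- Strictness in `IsStrictBest` makes the nearest lattice point unique at each chosen denominator,
which forces every best approximation sequence to be this one. -/
theorem isBestApproxSeq_of_best {N : Seminorm ℝ Plane} {v : Plane} {X : ℕ → Fin 3 → ℤ}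
    (h0 : X 0 0 = 1) (hmono : ∀ n, X n 0 < X (n + 1) 0)
    (hb : ∀ n, IsStrictBest N (X n) (X (n + 1)) v) :
    IsBestApproxSeq N v (fun n => (X n 0).toNat) (fun n => ![X n 1, X n 2]) ∧
      ∀ q p, IsBestApproxSeq N v q p →
        q = (fun n => (X n 0).toNat) ∧ p = fun n => ![X n 1, X n 2] := by
  have hsm : StrictMono fun n => X n 0 := strictMono_nat_of_lt_succ hmono
  have hpos : ∀ n, 1 ≤ X n 0 := fun n => h0 ▸ hsm.monotone (Nat.zero_le n)
  have hcast : ∀ n, (((X n 0).toNat : ℕ) : ℤ) = X n 0 := fun n =>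
    Int.toNat_of_nonneg (by linarith [hpos n])
  have hcastr : ∀ n, (((X n 0).toNat : ℕ) : ℝ) = X n 0 := fun n => by exact_mod_cast hcast n
  have hdisp : ∀ n, (((X n 0).toNat : ℕ) : ℝ) • v - intPoint ![X n 1, X n 2] = disp v (X n) := by
    intro n; rw [hcastr]; rfl
  have hge : ∀ n (k : ℕ), 1 ≤ k → (k : ℤ) < X (n + 1) 0 →
      N (disp v (X n)) ≤ latticeDist N ((k : ℝ) • v) := by
    intro n k hk1 hk2
    refine le_ciInf fun p => ?_
    rw [← disp_mk]
    by_cases h : ![(k : ℤ), p 0, p 1] = X n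
    · rw [h]
    · exact ((hb n).1 _ (by simpa using hk1) (by simpa using hk2) h).le
  have hdist : ∀ n, latticeDist N (((X n 0).toNat : ℝ) • v) = N (disp v (X n)) := by
    intro n
    apply le_antisymm
    · have := latticeDist_le N (((X n 0).toNat : ℝ) • v) ![X n 1, X n 2]
      rwa [hdisp] at this
    · refine hge n _ ?_ (by rw [hcast]; exact hmono n)
      have := hcast n
      have := hpos n
      omega
  have hleast : ∀ n, IsLeast {k : ℕ | 1 ≤ k ∧ latticeDist N ((k : ℝ) • v) <
      latticeDist N (((X n 0).toNat : ℝ) • v)} (X (n + 1) 0).toNat := by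
    intro n
    refine ⟨⟨?_, ?_⟩, ?_⟩
    · have := hcast (n + 1)
      have := hpos (n + 1)
      omega
    · rw [hdist, hdist]; exact (hb n).2
    · rintro k ⟨hk1, hk2⟩
      by_contra! hlt
      have h3 : (k : ℤ) < X (n + 1) 0 := by rw [← hcast]; exact_mod_cast hlt
      have := hge n k hk1 h3
      rw [hdist] at hk2
      linarith
  refine ⟨⟨by simp [h0], ?_, hleast, fun n => ?_⟩, ?_⟩
  · refine strictMono_nat_of_lt_succ fun n => ?_
    have h1 := hcast n
    have h2 := hcast (n + 1)
    have h3 := hmono n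
    omega
  · rw [hdist, hdisp]
  · intro q p h
    have hq : ∀ n, q n = (X n 0).toNat := by
      intro n
      induction n with
      | zero => simp [h0, h.q_zero]
      | succ n ih =>
        have h1 := h.isLeast n
        rw [ih] at h1
        exact h1.unique (hleast n)
    refine ⟨funext hq, funext fun n => ?_⟩
    have h1 := h.realises n
    rw [hq, hdist, ← disp_mk] at h1
    have h2 : ![(((X n 0).toNat : ℕ) : ℤ), p n 0, p n 1] = X n := by
      by_contra hne
      have := (hb n).1 _ (by simpa [hcast] using hpos n) (by simpa [hcast] using hmono n) hne
      linarith
    ext j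
    fin_cases j
    · simpa using congrFun h2 1
    · simpa using congrFun h2 2

/-- With `T = X n 0`, the growth of denominators turns the bound `M` for the long displacement into
`√T ⟨T v⟩ ≤ M / √(n + 1)`. -/
theorem not_badlyApproximable_of_best {N : Seminorm ℝ Plane} {v : Plane} {X : ℕ → Fin 3 → ℤ}
    (hpos : ∀ n, 1 ≤ X n 0) (hgrow : ∀ n : ℕ, (n + 1) * X n 0 ≤ X (n + 1) 0) {M : ℝ}
    (hM : ∀ n, √(X (n + 1) 0) * N (disp v (X n)) ≤ M) : ¬ BadlyApproximable N v := by
  intro h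
  unfold BadlyApproximable at h
  set c : ℝ := ⨅ T : {T : ℝ // 1 ≤ T}, √T.1 *
    ⨅ k : {k : ℕ // 1 ≤ k ∧ (k : ℝ) ≤ T.1}, latticeDist N ((k.1 : ℝ) • v) with hc
  have key : ∀ n : ℕ, c ^ 2 * (n + 1) ≤ M ^ 2 := by
    intro n
    have hp : (1 : ℝ) ≤ X n 0 := by exact_mod_cast hpos n
    have hg : ((n : ℝ) + 1) * X n 0 ≤ X (n + 1) 0 := by exact_mod_cast hgrow n
    have hcast : (((X n 0).toNat : ℕ) : ℝ) = X n 0 := by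
      have : (((X n 0).toNat : ℕ) : ℤ) = X n 0 := Int.toNat_of_nonneg (by linarith [hpos n])
      exact_mod_cast this
    have h1 : c ≤ √(X n 0) * N (disp v (X n)) := by
      refine (ciInf_le ⟨0, ?_⟩ (⟨(X n 0 : ℝ), hp⟩ : {T : ℝ // 1 ≤ T})).trans ?_
      · rintro _ ⟨T, rfl⟩
        exact mul_nonneg (Real.sqrt_nonneg _) (Real.iInf_nonneg fun _ => latticeDist_nonneg N _)
      · refine mul_le_mul_of_nonneg_left ?_ (Real.sqrt_nonneg _)
        refine (ciInf_le ⟨0, ?_⟩ (⟨(X n 0).toNat, ?_, hcast.le⟩ :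
          {k : ℕ // 1 ≤ k ∧ (k : ℝ) ≤ X n 0})).trans ?_
        · rintro _ ⟨k, rfl⟩
          exact latticeDist_nonneg N _
        · have := hpos n
          omega
        · refine (latticeDist_le N _ ![X n 1, X n 2]).trans ?_
          simp only [hcast]
          rfl
    have hn : (0 : ℝ) ≤ n := Nat.cast_nonneg n
    have h2 := hM n
    have h3 : 0 ≤ N (disp v (X n)) := apply_nonneg N _
    calc c ^ 2 * (n + 1) ≤ (√(X n 0) * N (disp v (X n))) ^ 2 * (n + 1) := by gcongr
      _ = ((n + 1) * X n 0) * N (disp v (X n)) ^ 2 := by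
          rw [mul_pow, Real.sq_sqrt (by linarith)]; ring
      _ ≤ X (n + 1) 0 * N (disp v (X n)) ^ 2 := by gcongr
      _ = (√(X (n + 1) 0) * N (disp v (X n))) ^ 2 := by
          rw [mul_pow, Real.sq_sqrt (le_trans (by positivity) hg)]
      _ ≤ M ^ 2 := by gcongr
  obtain ⟨n, hn⟩ := exists_nat_gt (M ^ 2 / c ^ 2)
  rw [div_lt_iff₀ (by positivity)] at hn
  nlinarith [key n, sq_nonneg c]

/-! ### A cone inside a sector and a quadrant -/

/-- A direction off both axes, so that a cone around it fits in one open quadrant. -/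
theorem exists_near_sin_two_mul_ne_zero (θ : ℝ) {δ : ℝ} (hδ : 0 < δ) :
    ∃ β, θ ≤ β ∧ β < θ + δ ∧ Real.sin (2 * β) ≠ 0 := by
  by_cases h : Real.sin (2 * θ) = 0
  · obtain ⟨t, ht0, htδ, ht1⟩ : ∃ t : ℝ, 0 < t ∧ t < δ ∧ t < 1 :=
      ⟨min δ 1 / 2, by positivity, by linarith [min_le_left δ 1, lt_min hδ one_pos],
        by linarith [min_le_right δ 1, lt_min hδ one_pos]⟩
    refine ⟨θ + t, by linarith, by linarith, ?_⟩
    have hc : Real.cos (2 * θ) ≠ 0 := by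
      intro hc
      have := Real.sin_sq_add_cos_sq (2 * θ)
      rw [h, hc] at this
      norm_num at this
    rw [mul_add, Real.sin_add, h, zero_mul, zero_add]
    exact mul_ne_zero hc (Real.sin_pos_of_pos_of_lt_pi (by linarith)
      (by linarith [Real.pi_gt_three])).ne'
  · exact ⟨θ, le_rfl, by linarith, h⟩

theorem exists_cone (θ : ℝ) {δ : ℝ} (hδ : 0 < δ) : ∃ K : Set Plane, IsOpen K ∧ K.Nonempty ∧
    (∀ r : ℝ, 0 < r → ∀ u ∈ K, r • u ∈ K) ∧ (∀ u ∈ K, ∀ r : ℝ, r • u ∈ sector θ δ) ∧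
    ∀ u ∈ K, ∀ w ∈ K, 0 < u 0 * w 0 ∧ 0 < u 1 * w 1 := by
  obtain ⟨β, hβ1, hβ2, hβ⟩ := exists_near_sin_two_mul_ne_zero θ hδ
  rw [Real.sin_two_mul] at hβ
  have hs : Real.sin β ≠ 0 := fun h => hβ (by rw [h]; ring)
  have hcs : Real.cos β ≠ 0 := fun h => hβ (by rw [h]; ring)
  obtain ⟨ε, hε0, hε⟩ : ∃ ε : ℝ, 0 < ε ∧ ε < θ + δ - β := exists_between (by linarith)
  -- Rotation by `-β` places the chosen direction on the positive real axis, where the argument is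
  -- continuous and measures the deviation from `β`.
  let Z : Plane → ℂ := fun u => ⟨u 0 * Real.cos β + u 1 * Real.sin β,
    u 1 * Real.cos β - u 0 * Real.sin β⟩
  have hZ : Continuous Z := by
    have : Z = fun u => Complex.ofReal (u 0 * Real.cos β + u 1 * Real.sin β) +
        Complex.ofReal (u 1 * Real.cos β - u 0 * Real.sin β) * Complex.I := by
      funext u; apply Complex.ext <;> simp [Z, -Complex.ofReal_add, -Complex.ofReal_sub, -Complex.ofReal_mul]
    rw [this]; fun_prop
  have hZs : ∀ (r : ℝ) u, Z (r • u) = r * Z u := by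
    intro r u
    apply Complex.ext <;> simp [Z] <;> ring
  let V : Set ℂ := Complex.slitPlane ∩ Complex.arg ⁻¹' Set.Ioo (-ε) ε
  have hV : IsOpen V := ContinuousOn.isOpen_inter_preimage
    (fun z hz => (Complex.continuousAt_arg hz).continuousWithinAt) Complex.isOpen_slitPlane
    isOpen_Ioo
  refine ⟨Z ⁻¹' V ∩ {u | 0 < u 0 * Real.cos β} ∩ {u | 0 < u 1 * Real.sin β}, ?_, ?_, ?_, ?_, ?_⟩
  · refine ((hV.preimage hZ).inter (isOpen_lt continuous_const ?_)).inter
      (isOpen_lt continuous_const ?_) <;> fun_prop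
  · refine ⟨![Real.cos β, Real.sin β], ⟨?_, ?_⟩, ?_⟩
    · have : Z ![Real.cos β, Real.sin β] = 1 := by
        apply Complex.ext
        · simp only [Z, Matrix.cons_val_zero, Matrix.cons_val_one, Complex.one_re]
          nlinarith [Real.sin_sq_add_cos_sq β]
        · simp only [Z, Matrix.cons_val_zero, Matrix.cons_val_one, Complex.one_im]
          ring
      simp [V, this, hε0]
    · simpa using mul_self_pos.2 hcs
    · simpa using mul_self_pos.2 hs
  · rintro r hr u ⟨⟨hu1, hu2⟩, hu3⟩
    refine ⟨⟨?_, ?_⟩, ?_⟩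
    · have h0 := hu1.1
      refine ⟨?_, ?_⟩
      · rw [hZs]
        rw [Complex.mem_slitPlane_iff] at h0 ⊢
        simp only [Complex.re_ofReal_mul, Complex.im_ofReal_mul]
        rcases h0 with h | h
        · left; positivity
        · right; exact mul_ne_zero hr.ne' h
      · rw [Set.mem_preimage, hZs, Complex.arg_real_mul _ hr]
        exact hu1.2
    · simp only [Set.mem_ofPred_eq, Pi.smul_apply, smul_eq_mul] at hu2 ⊢
      rw [mul_assoc]; positivity
    · simp only [Set.mem_ofPred_eq, Pi.smul_apply, smul_eq_mul] at hu3 ⊢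
      rw [mul_assoc]; positivity
  · rintro u ⟨⟨⟨-, hu1⟩, -⟩, -⟩ r
    have hc := Complex.norm_mul_cos_arg (Z u)
    have hs := Complex.norm_mul_sin_arg (Z u)
    set φ := Complex.arg (Z u)
    have e := Real.sin_sq_add_cos_sq β
    refine ⟨r * ‖Z u‖, β + φ, by linarith [hu1.1], by linarith [hu1.2], ?_⟩
    change ‖Z u‖ * _ = u 0 * Real.cos β + u 1 * Real.sin β at hc
    change ‖Z u‖ * _ = u 1 * Real.cos β - u 0 * Real.sin β at hs
    apply plane_ext
    · simp only [Pi.smul_apply, smul_eq_mul, Matrix.cons_val_zero, Real.cos_add]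
      linear_combination (-r * Real.cos β) * hc + (r * Real.sin β) * hs + (-r * u 0) * e
    · simp only [Pi.smul_apply, smul_eq_mul, Matrix.cons_val_one,
        Matrix.cons_val_fin_one, Real.sin_add]
      linear_combination (-r * Real.sin β) * hc - (r * Real.cos β) * hs + (-r * u 1) * e
  · rintro u ⟨⟨-, hu2⟩, hu3⟩ w ⟨⟨-, hw2⟩, hw3⟩
    simp only [Set.mem_ofPred_eq] at *
    constructor
    · have : 0 < (u 0 * w 0) * Real.cos β ^ 2 := by
        calc 0 < (u 0 * Real.cos β) * (w 0 * Real.cos β) := mul_pos hu2 hw2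
          _ = _ := by ring
      exact pos_of_mul_pos_left this (sq_nonneg _)
    · have : 0 < (u 1 * w 1) * Real.sin β ^ 2 := by
        calc 0 < (u 1 * Real.sin β) * (w 1 * Real.sin β) := mul_pos hu3 hw3
          _ = _ := by ring
      exact pos_of_mul_pos_left this (sq_nonneg _)

theorem exists_primitive_mem_cone {K : Set Plane} (hKo : IsOpen K) (hKn : K.Nonempty)
    (hKs : ∀ r : ℝ, 0 < r → ∀ u ∈ K, r • u ∈ K) (hK0 : (0 : Plane) ∉ K) :
    ∃ b : Fin 2 → ℤ, intPoint b ∈ K ∧ IsCoprime (b 0) (b 1) := by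
  have hd : DenseRange (Pi.map fun (_ : Fin 2) (x : ℚ) => (x : ℝ)) :=
    DenseRange.piMap fun _ => Rat.denseRange_cast
  obtain ⟨x, hx⟩ := hd.exists_mem_open hKo hKn
  set e : ℤ × ℤ := (⟨(x 0).num * (x 1).den, (x 1).num * (x 0).den⟩ : ℤ × ℤ) with he
  have h0 : ((x 0).den : ℝ) ≠ 0 := by exact_mod_cast (x 0).den_ne_zero
  have h1 : ((x 1).den : ℝ) ≠ 0 := by exact_mod_cast (x 1).den_ne_zero
  have hmem : (![(e.1 : ℝ), (e.2 : ℝ)] : Plane) ∈ K := by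
    have hr : (0 : ℝ) < (x 0).den * (x 1).den := by
      exact_mod_cast Nat.mul_pos (x 0).den_pos (x 1).den_pos
    convert hKs _ hr _ hx using 1
    apply plane_ext
    · simp only [he, Pi.smul_apply, smul_eq_mul, Pi.map_apply, Matrix.cons_val_zero]
      rw [Rat.cast_def (x 0)]
      push_cast
      field_simp
    · simp only [he, Pi.smul_apply, smul_eq_mul, Pi.map_apply, Matrix.cons_val_one]
      rw [Rat.cast_def (x 1)]
      push_cast
      field_simp
  have hg : Int.gcd e.1 e.2 ≠ 0 := by
    intro h
    rw [Int.gcd_eq_zero_iff] at h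
    apply hK0
    rw [h.1, h.2] at hmem
    convert hmem using 1
    apply plane_ext <;> simp
  obtain ⟨a, b, hab, h3, h4⟩ := Int.exists_gcd_one (Nat.pos_of_ne_zero hg)
  set k := Int.gcd e.1 e.2
  refine ⟨![a, b], ?_, by simpa using Int.isCoprime_iff_gcd_eq_one.2 hab⟩
  have hk : (0 : ℝ) < k := by exact_mod_cast Nat.pos_of_ne_zero hg
  convert hKs (k : ℝ)⁻¹ (by positivity) _ hmem using 1
  have h3' : (e.1 : ℝ) = a * k := by exact_mod_cast h3
  have h4' : (e.2 : ℝ) = b * k := by exact_mod_cast h4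
  apply plane_ext
  · simp [intPoint, h3']; field_simp
  · simp [intPoint, h4']; field_simp

/-! ### Binary trees of choices -/

/-- The free lower bound `L` supplies two successors: the second is asked to exceed the height of
the first, so heights along a branch determine the branch. -/
theorem exists_binary_tree {α : Type*} {I : ℕ → α → Prop} {R : ℕ → α → α → Prop} (h : α → ℤ)
    (step : ∀ n S, I n S → ∀ L : ℤ, ∃ T, I (n + 1) T ∧ R n S T ∧ L < h T) {S₀ : α} (h₀ : I 0 S₀) :
    ∃ F : (ℕ → Bool) → ℕ → α, (∀ b, F b 0 = S₀) ∧ (∀ b n, I n (F b n)) ∧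
      (∀ b n, R n (F b n) (F b (n + 1))) ∧
      ∀ b b', (∀ n, h (F b n) = h (F b' n)) → b = b' := by
  choose! f hfI hfR hfL using step
  let next : ℕ → Bool → α → α := fun n b S => if b then f n S 0 else f n S (h (f n S 0))
  let F : (ℕ → Bool) → ℕ → α := fun b n => Nat.rec S₀ (fun n S => next n (b n) S) n
  have hF : ∀ b n, F b (n + 1) = next n (b n) (F b n) := fun _ _ => rfl
  have hI : ∀ b n, I n (F b n) := by
    intro b n
    induction n with
    | zero => exact h₀
    | succ n ih =>
      rw [hF]
      simp only [next]
      split_ifs <;> exact hfI _ _ ih _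
  refine ⟨F, fun _ => rfl, hI, fun b n => ?_, fun b b' hb => ?_⟩
  · rw [hF]
    simp only [next]
    split_ifs <;> exact hfR _ _ (hI b n) _
  · have key : ∀ n S, I n S → ∀ x y, h (next n x S) = h (next n y S) → x = y := by
      intro n S hS x y hxy
      have := hfL n S hS (h (f n S 0))
      cases x <;> cases y <;> simp [next] at hxy ⊢ <;> omega
    have hn : ∀ n, F b n = F b' n := by
      intro n
      induction n with
      | zero => rfl
      | succ n ih =>
        have h1 := hb (n + 1)
        rw [hF, hF, ← ih] at h1
        rw [hF, hF, ← ih, key n _ (hI b n) _ _ h1]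
    funext n
    have h1 := hb (n + 1)
    rw [hF, hF, ← hn] at h1
    exact key n _ (hI b n) _ _ h1

/-! ### The tree of best approximation vectors -/

/-- `A` is recovered from the new vector because `g` is its own inverse. -/
theorem Spans.next {A B C : Fin 3 → ℤ} (h : Spans A B C) {g : ℤ} (hg : g ^ 2 = 1) (s i : ℤ) :
    Spans B C (s • C + i • B + g • A) := by
  intro Y
  obtain ⟨b, a, d, rfl⟩ := h Y
  refine ⟨d - a * g * s, b - a * g * i, a * g, ?_⟩
  ext j
  simp only [Pi.add_apply, Pi.smul_apply, smul_eq_mul]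
  linear_combination (-(a * A j)) * hg

theorem det3_next_sq (A B C : Fin 3 → ℤ) {g : ℤ} (hg : g ^ 2 = 1) (s i : ℤ) :
    det3 B C (s • C + i • B + g • A) ^ 2 = det3 A B C ^ 2 := by
  have : det3 B C (s • C + i • B + g • A) = g * det3 A B C := by
    simp only [det3, Pi.add_apply, Pi.smul_apply, smul_eq_mul]; ring
  rw [this, mul_pow, hg, one_mul]

theorem exists_basis_of_spans {A B C : Fin 3 → ℤ} (h : Spans A B C) :
    ∃ b : Module.Basis (Fin 3) ℤ (Fin 3 → ℤ), ⇑b = ![A, B, C] := by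
  have hs : ⊤ ≤ Submodule.span ℤ (Set.range ![A, B, C]) := by
    rintro Y -
    obtain ⟨b, a, d, rfl⟩ := h Y
    have hm : ∀ j, ![A, B, C] j ∈ Submodule.span ℤ (Set.range ![A, B, C]) := fun j =>
      Submodule.subset_span ⟨j, rfl⟩
    exact add_mem (add_mem (Submodule.smul_mem _ _ (hm 2)) (Submodule.smul_mem _ _ (hm 1)))
      (Submodule.smul_mem _ _ (hm 0))
  have hl : LinearIndependent ℤ ![A, B, C] :=
    linearIndependent_of_top_le_span_of_card_eq_finrank hs (by simp)
  exact ⟨Module.Basis.mk hl hs, by simp⟩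

/-- Three successive approximation vectors together with the radius of a ball around the last one's
rational point. -/
structure ApproxState where
  A : Fin 3 → ℤ
  B : Fin 3 → ℤ
  C : Fin 3 → ℤ
  ρ : ℝ

/-- The state is at level `n`: its vectors form a lattice basis, the signed displacement lies in the
cone `K`, and the denominators have the residues prescribed by `z`. -/
structure ApproxState.Valid (K : Set Plane) (m : ℕ) (z : ℤ → ℤ) (n : ℕ) (S : ApproxState) :
    Prop where
  det : det3 S.A S.B S.C ^ 2 = 1
  spans : Spans S.A S.B S.C
  nonneg : 0 ≤ S.B 0
  lt : S.B 0 < S.C 0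
  mem : (-1 : ℝ) ^ n • disp (foot S.C) S.B ∈ K
  modC : S.C 0 ≡ z n [ZMOD m]
  modB : S.B 0 ≡ z (n - 1) [ZMOD m]
  modA : S.A 0 ≡ z (n - 2) [ZMOD m]
  ρ_pos : 0 < S.ρ

/-- The closed ball around the last rational point of the state. -/
def ApproxState.ball (S : ApproxState) : Set Plane := Metric.closedBall (foot S.C) S.ρ

/-- `T` is an admissible successor of the state `S` at level `n`. -/
structure ApproxState.Next (N : Seminorm ℝ Plane) (K : Set Plane) (l r : ℕ → ℝ) (n : ℕ)
    (S T : ApproxState) : Prop where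
  A_eq : T.A = S.B
  B_eq : T.B = S.C
  grow : (n + 1) * S.C 0 ≤ T.C 0
  lt : S.C 0 < T.C 0
  ball_subset : T.ball ⊆ S.ball
  tie : ∀ v ∈ T.ball, N (disp v S.B) < N (disp v (S.C - S.B))
  good : ∀ v ∈ T.ball, N (disp v T.B) < N (disp v (T.C - T.B)) →
    IsStrictBest N T.B T.C v ∧ l n ≤ √(T.C 0) * N (disp v T.B) ∧ √(T.C 0) * N (disp v T.B) ≤ r n ∧
      (-1 : ℝ) ^ (n + 1) • disp v T.B ∈ K

/-- All conclusions of `exists_next_vector` are open conditions at `foot X`, apart from the tie of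
`C` with `X - C`, so they persist on a small closed ball; the tie is settled one level later by the
field `tie`. -/
theorem exists_next_state (N : Seminorm ℝ Plane) {a c : ℝ} (ha : 0 < a) (hc : 0 < c)
    (hQ : ∀ u, a * u 0 ^ 2 + c * u 1 ^ 2 ≤ N u ^ 2) {K : Set Plane} (hKo : IsOpen K)
    (hKs : ∀ r : ℝ, 0 < r → ∀ u ∈ K, r • u ∈ K) {m : ℕ} (hm : 0 < m) {z : ℤ → ℤ}
    (hz : AdmissibleResidues m z) {l r : ℕ → ℝ} (hlr : ∀ n, l n < r n) (hl : ∀ n, 0 ≤ l n)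
    (hr : ∀ n, 3 * r n ^ 4 ≤ 4 * (a * c)) (n : ℕ) (S : ApproxState) (hS : S.Valid K m z n)
    (L : ℤ) : ∃ T : ApproxState, T.Valid K m z (n + 1) ∧ S.Next N K l r n T ∧ L < T.C 0 := by
  obtain ⟨s₀, i₀, g, hg, hz'⟩ : ∃ s₀ i₀ g : ℤ, g ^ 2 = 1 ∧
      z (n + 1) ≡ s₀ * z n + i₀ * z (n - 1) + g * z (n - 2) [ZMOD m] := by
    obtain ⟨s, i, h⟩ := hz.step (n + 1) (by omega)
    rw [show ((n : ℤ) + 1 - 1) = n by ring, show ((n : ℤ) + 1 - 2) = n - 1 by ring,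
      show ((n : ℤ) + 1 - 3) = n - 2 by ring] at h
    rcases h with h | h
    · exact ⟨s, i, 1, by norm_num, by simpa using h⟩
    · exact ⟨s, i, -1, by norm_num, by simpa [sub_eq_add_neg] using h⟩
  -- Working strictly inside the interval lets the bounds survive perturbation and makes the
  -- inequality for `t₂` strict.
  obtain ⟨t₁, hlt₁, ht₁r⟩ := exists_between (hlr n)
  obtain ⟨t₂, ht₁₂, ht₂r⟩ := exists_between ht₁r
  have ht₁ : 0 < t₁ := (hl n).trans_lt hlt₁
  have ht₂ : 3 * t₂ ^ 4 < 4 * (a * c) := by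
    refine lt_of_lt_of_le ?_ (hr n)
    have : 0 < t₂ := ht₁.trans ht₁₂
    gcongr
  -- Each step reverses the displacement; the sign `(-1) ^ n` absorbs this.
  let K' : Set Plane := {u | (-1 : ℝ) ^ n • u ∈ K}
  have hK'o : IsOpen K' := hKo.preimage (continuous_const_smul _)
  have hK's : ∀ r : ℝ, 0 < r → ∀ u ∈ K', r • u ∈ K' := by
    intro r hr u hu
    change (-1 : ℝ) ^ n • r • u ∈ K
    rw [smul_comm]
    exact hKs r hr _ hu
  have hU : interior S.ball ∈ 𝓝 (foot S.C) :=
    interior_mem_nhds.2 (Metric.closedBall_mem_nhds _ hS.ρ_pos)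
  obtain ⟨s, i, hs, hi, X, hX, hLX, hX0, hXU, hX1, hX2, hXK, hXtie, hXs⟩ :=
    exists_next_vector N ha hc hQ hK'o hK's hS.det hS.nonneg hS.lt hS.mem hm s₀ i₀ hg ht₁ ht₁₂ ht₂
      (max (L : ℝ) ((n + 1) * S.C 0)) hU
  obtain ⟨κ, hκ, hκN⟩ := exists_norm_le_of_ellipsoid ha hc hQ
  have hC0 : 0 < S.C 0 := hS.nonneg.trans_lt hS.lt
  have hgrow : (n + 1) * S.C 0 < X 0 := by
    exact_mod_cast (le_max_right _ _).trans_lt hLX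
  have hCX : S.C 0 < X 0 := by nlinarith
  have hXK' : (-1 : ℝ) ^ (n + 1) • disp (foot X) S.C ∈ K := by
    have : (-1 : ℝ) ^ n • -disp (foot X) S.C ∈ K := hXK
    rwa [smul_neg, ← neg_smul, ← neg_one_mul, ← pow_succ'] at this
  have hspan : Spans S.B S.C X := by rw [hX]; exact hS.spans.next hg s i
  have hXpos : 0 < N (disp (foot X) S.C) := by
    have : 0 < √(X 0) * N (disp (foot X) S.C) := ht₁.trans_le hX1
    exact pos_of_mul_pos_right this (Real.sqrt_nonneg _)
  have hbest := eventually_best hκ hκN hspan hC0.le hCX hXpos hXs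
  have hcont : Continuous fun v => √(X 0) * N (disp v S.C) :=
    continuous_const.mul (continuous_seminorm_disp N S.C)
  have hcd : Continuous fun v => (-1 : ℝ) ^ (n + 1) • disp v S.C := by
    unfold disp; fun_prop
  have hev := hbest.and <|
    ((hcont.tendsto (foot X)).eventually_const_lt (hlt₁.trans_le hX1)).and <|
    ((hcont.tendsto (foot X)).eventually_lt_const (hX2.trans_lt ht₂r)).and <|
    ((hcd.tendsto (foot X)).eventually (hKo.mem_nhds hXK')).and <|
    ((continuous_seminorm_disp N S.B).continuousAt.eventually_lt
      (continuous_seminorm_disp N (S.C - S.B)).continuousAt hXtie).and <|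
    isOpen_interior.mem_nhds hXU
  obtain ⟨ρ, hρ, hball⟩ := (Metric.nhds_basis_closedBall.eventually_iff).1 hev
  refine ⟨⟨S.B, S.C, X, ρ⟩, ⟨?_, hspan, hC0.le, hCX, hXK', ?_, ?_, ?_, hρ⟩,
    ⟨rfl, rfl, hgrow.le, hCX, fun v hv => interior_subset (hball hv).2.2.2.2.2,
      fun v hv => (hball hv).2.2.2.2.1, fun v hv ht => ?_⟩, ?_⟩
  · change det3 S.B S.C X ^ 2 = 1
    rw [hX, det3_next_sq _ _ _ hg, hS.det]
  · push_cast
    refine Int.ModEq.trans ?_ hz'.symm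
    rw [hX]
    exact ((hs.mul hS.modC).add (hi.mul hS.modB)).add ((Int.ModEq.refl g).mul hS.modA)
  · push_cast
    rw [show ((n : ℤ) + 1 - 1) = n by ring]
    exact hS.modC
  · push_cast
    rw [show ((n : ℤ) + 1 - 2) = n - 1 by ring]
    exact hS.modB
  · obtain ⟨h1, h2, h3, h4, -⟩ := hball hv
    exact ⟨h1 ht, h2.le, h3.le, h4⟩
  · exact_mod_cast (le_max_left _ _).trans_lt hLX

theorem exists_initial_state {K : Set Plane} (hKo : IsOpen K) (hKn : K.Nonempty)
    (hKs : ∀ r : ℝ, 0 < r → ∀ u ∈ K, r • u ∈ K) (hK0 : (0 : Plane) ∉ K) {m : ℕ} {z : ℤ → ℤ}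
    (hz : AdmissibleResidues m z) :
    ∃ S : ApproxState, S.Valid K m z 0 ∧ S.C = ![1, 0, 0] := by
  obtain ⟨b, hbK, s, t, hst⟩ := exists_primitive_mem_cone hKo hKn hKs hK0
  -- The denominators `0, 0, 1` match `z (-2), z (-1), z 0`. The displacement of `B` from the origin
  -- is the primitive vector `b` in the cone, and its Bézout coefficients complete the basis.
  refine ⟨⟨![0, t, -s], ![0, -b 0, -b 1], ![1, 0, 0], 1⟩,
    ⟨?_, ?_, ?_, ?_, ?_, ?_, ?_, ?_, one_pos⟩, rfl⟩
  · have : det3 ![0, t, -s] ![0, -b 0, -b 1] ![1, 0, 0] = -1 := by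
      simp [det3]; linarith
    simp only [this]; norm_num
  · intro Y
    refine ⟨-(s * Y 1 + t * Y 2), -(b 0 * Y 2 - b 1 * Y 1), Y 0, ?_⟩
    ext j
    fin_cases j
    · simp
    · simp; linear_combination (-Y 1) * hst
    · simp; linear_combination (-Y 2) * hst
  · simp
  · simp
  · rw [pow_zero, one_smul]
    convert hbK using 1
    apply plane_ext <;> simp [disp, intPoint]
  · simp [hz.zero]
  · simp [hz.neg_one]
  · simp [hz.neg_two]

theorem oppositeQuadrants_of_pos {e : ℝ} (he : e * e = 1) {x y : Plane}
    (h : 0 < (e • x) 0 * ((e * -1) • y) 0 ∧ 0 < (e • x) 1 * ((e * -1) • y) 1) :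
    OppositeQuadrants x y := by
  simp only [Pi.smul_apply, smul_eq_mul] at h
  have key : ∀ s t : ℝ, 0 < e * s * (e * -1 * t) → s * t < 0 := by
    intro s t h
    have : e * s * (e * -1 * t) = -(s * t) := by linear_combination (-(s * t)) * he
    linarith
  exact ⟨key _ _ h.1, key _ _ h.2⟩

theorem cardinal_eq_continuum_of_injection {s : Set Plane} (f : (ℕ → Bool) → Plane)
    (hf : Function.Injective f) (hs : ∀ b, f b ∈ s) : #s = 𝔠 := by
  apply le_antisymm
  · refine (Cardinal.mk_set_le s).trans ?_
    rw [Cardinal.mk_congr (finTwoArrowEquiv ℝ), Cardinal.mk_prod]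
    simp [Cardinal.mk_real]
  · have h : #(ℕ → Bool) ≤ #s :=
      Cardinal.mk_le_of_injective (f := fun b => (⟨f b, hs b⟩ : s)) fun b b' h =>
        hf (congrArg Subtype.val h)
    simpa using h

theorem exists_mem_nested_closedBall (S : ℕ → ApproxState) (hρ : ∀ n, 0 < (S n).ρ)
    (hsub : ∀ n, (S (n + 1)).ball ⊆ (S n).ball) : ∃ v, ∀ n, v ∈ (S n).ball := by
  have h := IsCompact.nonempty_iInter_of_sequence_nonempty_isCompact_isClosed
    (fun n => (S n).ball) hsub (fun n => Metric.nonempty_closedBall.2 (hρ n).le)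
    (isCompact_closedBall _ _) (fun n => Metric.isClosed_closedBall)
  obtain ⟨v, hv⟩ := h
  exact ⟨v, fun n => Set.mem_iInter.1 hv n⟩

theorem card_prescribed_eq_continuum (N : Seminorm ℝ Plane) {a c : ℝ} (ha : 0 < a) (hc : 0 < c)
    (hQ : ∀ u, a * u 0 ^ 2 + c * u 1 ^ 2 ≤ N u ^ 2) {M : ℝ} (hM : 3 * M ^ 4 ≤ 4 * (a * c))
    (θ : ℝ) {δ : ℝ} (hδ : 0 < δ) {l r : ℕ → ℝ} (hlr : ∀ n, l n < r n)
    (hI : ∀ n, Set.Icc (l n) (r n) ⊆ Set.Icc 0 M) {m : ℕ} {z : ℤ → ℤ} (hm : 0 < m)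
    (hz : AdmissibleResidues m z) :
    #{v : Plane |
        (∃ q p, IsBestApproxSeq N v q p) ∧
        ¬ BadlyApproximable N v ∧
        ∀ q p, IsBestApproxSeq N v q p →
          (∀ n, N (longDisplacement v q p n) ∈ Set.Icc (l n) (r n)) ∧
          (∀ n, longDisplacement v q p n ∈ sector θ δ) ∧
          (∀ n, OppositeQuadrants (longDisplacement v q p n)
            (longDisplacement v q p (n + 1))) ∧
          (∀ n : ℕ, 1 ≤ n → (q n : ℤ) ≡ z n [ZMOD m]) ∧
          (∀ n, 2 ≤ n → ∃ b : Module.Basis (Fin 3) ℤ (Fin 3 → ℤ),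
            ⇑b = ![approxVector (q (n - 2)) (p (n - 2)),
              approxVector (q (n - 1)) (p (n - 1)), approxVector (q n) (p n)])} = 𝔠 := by
  obtain ⟨K, hKo, hKn, hKs, hKsec, hKq⟩ := exists_cone θ hδ
  have hK0 : (0 : Plane) ∉ K := fun h => by simpa using (hKq 0 h 0 h).1
  have hl : ∀ n, 0 ≤ l n := fun n => (hI n (Set.left_mem_Icc.2 (hlr n).le)).1
  have hrM : ∀ n, r n ≤ M := fun n => (hI n (Set.right_mem_Icc.2 (hlr n).le)).2
  have hr4 : ∀ n, 3 * r n ^ 4 ≤ 4 * (a * c) := fun n => by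
    refine le_trans ?_ hM
    have := hrM n
    have : 0 ≤ r n := (hl n).trans (hlr n).le
    gcongr
  obtain ⟨S₀, hS₀, hS₀C⟩ := exists_initial_state hKo hKn hKs hK0 hz
  obtain ⟨F, hF0, hFv, hFn, hFinj⟩ := exists_binary_tree (fun S : ApproxState => S.C 0)
    (exists_next_state N ha hc hQ hKo hKs hm hz hlr hl hr4) hS₀
  have hex : ∀ b, ∃ v, ∀ n, v ∈ (F b n).ball := fun b =>
    exists_mem_nested_closedBall (F b) (fun n => (hFv b n).ρ_pos) fun n => (hFn b n).ball_subset
  choose f hf using hex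
  have hgood : ∀ b n, IsStrictBest N (F b n).C (F b (n + 1)).C (f b) ∧
      l n ≤ √((F b (n + 1)).C 0) * N (disp (f b) (F b n).C) ∧
      √((F b (n + 1)).C 0) * N (disp (f b) (F b n).C) ≤ r n ∧
      (-1 : ℝ) ^ (n + 1) • disp (f b) (F b n).C ∈ K := by
    intro b n
    have h1 := (hFn b n).good (f b) (hf b _)
    have h2 := (hFn b (n + 1)).tie (f b) (hf b _)
    have h3 := h1 h2
    rwa [(hFn b n).B_eq] at h3
  have hseq : ∀ b, _ := fun b => isBestApproxSeq_of_best (N := N) (v := f b)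
    (X := fun n => (F b n).C) (by simp [hF0, hS₀C]) (fun n => (hFn b n).lt) fun n => (hgood b n).1
  have hCpos : ∀ b n, 0 < (F b n).C 0 := fun b n => (hFv b n).nonneg.trans_lt (hFv b n).lt
  have hcast : ∀ b n, ((((F b n).C 0).toNat : ℕ) : ℤ) = (F b n).C 0 := fun b n =>
    Int.toNat_of_nonneg (hCpos b n).le
  have hcastr : ∀ b n, ((((F b n).C 0).toNat : ℕ) : ℝ) = (F b n).C 0 := fun b n => by
    exact_mod_cast hcast b n
  refine cardinal_eq_continuum_of_injection f (fun b b' hbb => hFinj b b' fun n => ?_) fun b => ?_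
  -- Equal points have the same best approximation denominators, and these determine the branch.
  · have h1 := (hseq b).1
    rw [hbb] at h1
    have h2 := congrFun ((hseq b').2 _ _ h1).1 n
    rw [← hcast b, ← hcast b', h2]
  · refine ⟨⟨_, _, (hseq b).1⟩, ?_, ?_⟩
    · exact not_badlyApproximable_of_best (X := fun n => (F b n).C) (M := M)
        (fun n => hCpos b n) (fun n => (hFn b n).grow)
        fun n => (hgood b n).2.2.1.trans (hrM n)
    · intro q p hqp
      obtain ⟨rfl, rfl⟩ := (hseq b).2 q p hqp
      have hld : ∀ n, longDisplacement (f b) (fun n => ((F b n).C 0).toNat)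
          (fun n => ![(F b n).C 1, (F b n).C 2]) n
          = √((F b (n + 1)).C 0) • disp (f b) (F b n).C := by
        intro n
        simp only [longDisplacement, hcastr]
        rfl
      have hsq : ∀ n, 0 < √(((F b n).C 0 : ℤ) : ℝ) := fun n =>
        Real.sqrt_pos.2 (by exact_mod_cast hCpos b n)
      have hav : ∀ n, approxVector ((F b n).C 0).toNat ![(F b n).C 1, (F b n).C 2]
          = (F b n).C := by
        intro n
        ext j
        fin_cases j <;> simp [approxVector, (hCpos b n).le]
      refine ⟨fun n => ?_, fun n => ?_, fun n => ?_, fun n _ => ?_, fun n hn => ?_⟩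
      · rw [hld, map_smul_eq_mul, Real.norm_of_nonneg (hsq _).le]
        exact ⟨(hgood b n).2.1, (hgood b n).2.2.1⟩
      · rw [hld]
        have h1 := hKsec _ (hgood b n).2.2.2 (√((F b (n + 1)).C 0) * (-1) ^ (n + 1))
        rwa [smul_smul, mul_assoc, ← mul_pow, neg_one_mul, neg_neg, one_pow, mul_one] at h1
      · rw [hld, hld]
        have h1 := hKs _ (hsq (n + 1)) _ (hgood b n).2.2.2
        have h2 := hKs _ (hsq (n + 1 + 1)) _ (hgood b (n + 1)).2.2.2
        rw [smul_comm] at h1 h2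
        rw [pow_succ _ (n + 1)] at h2
        exact oppositeQuadrants_of_pos (by rw [← mul_pow]; simp) (hKq _ h1 _ h2)
      · rw [hcast]
        exact (hFv b n).modC
      · obtain ⟨k, rfl⟩ := Nat.exists_eq_add_of_le' hn
        have h1 := (hFv b (k + 2)).spans
        rw [(hFn b (k + 1)).A_eq, (hFn b (k + 1)).B_eq, (hFn b k).B_eq] at h1
        simp only [show k + 2 - 2 = k by omega, show k + 2 - 1 = k + 1 by omega, hav]
        exact exists_basis_of_spans h1

/-! ### Best ellipsoid norms -/

theorem ellipsoidConst_pow_four {a c D : ℝ} (ha : 0 ≤ a) (hc : 0 ≤ c) (hD : 1 ≤ D) :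
    ellipsoidConst a c D ^ 4 = 4 * a * c / (4 * D ^ 2 - 1) := by
  have : 0 < 4 * D ^ 2 - 1 := by nlinarith
  rw [ellipsoidConst, ← Real.rpow_natCast, ← Real.rpow_mul (by positivity)]
  norm_num

theorem ellipsoidConst_le {a c D a' c' D' : ℝ} (ha : 0 ≤ a') (hc : 0 ≤ c') (hD : 1 ≤ D')
    (h : 4 * a' * c' / (4 * D' ^ 2 - 1) ≤ 4 * a * c / (4 * D ^ 2 - 1)) :
    ellipsoidConst a' c' D' ≤ ellipsoidConst a c D := by
  have : 0 < 4 * D' ^ 2 - 1 := by nlinarith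
  exact Real.rpow_le_rpow (by positivity) h (by norm_num)

theorem IsEllipsoidNormFor.sq_lower {N : Seminorm ℝ Plane} {a c D : ℝ}
    (h : IsEllipsoidNormFor N a c D) (u : Plane) : a * u 0 ^ 2 + c * u 1 ^ 2 ≤ N u ^ 2 :=
  (Real.sqrt_le_iff.1 (h.lower u)).2

theorem IsEllipsoidNormFor.sq_upper {N : Seminorm ℝ Plane} {a c D : ℝ}
    (h : IsEllipsoidNormFor N a c D) (u : Plane) :
    N u ^ 2 ≤ D ^ 2 * (a * u 0 ^ 2 + c * u 1 ^ 2) := by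
  have h0 := h.a_pos
  have h1 := h.c_pos
  have h2 : N u ^ 2 ≤ (D * ellipsoidNorm a c u) ^ 2 :=
    pow_le_pow_left₀ (apply_nonneg N u) (h.upper u) 2
  rwa [mul_pow, ellipsoidNorm, Real.sq_sqrt (by positivity)] at h2

theorem isEllipsoidNormFor_of_sq {N : Seminorm ℝ Plane} {a c D : ℝ} (ha : 0 < a) (hc : 0 < c)
    (hD : 1 ≤ D) (h₁ : ∀ u, a * u 0 ^ 2 + c * u 1 ^ 2 ≤ N u ^ 2)
    (h₂ : ∀ u, N u ^ 2 ≤ D ^ 2 * (a * u 0 ^ 2 + c * u 1 ^ 2)) : IsEllipsoidNormFor N a c D := by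
  refine ⟨ha, hc, hD, fun u => Real.sqrt_le_iff.2 ⟨apply_nonneg N u, h₁ u⟩, fun u => ?_⟩
  refine le_of_sq_le_sq ?_ (mul_nonneg (by linarith) (Real.sqrt_nonneg _))
  rw [mul_pow, ellipsoidNorm, Real.sq_sqrt (by positivity)]
  exact h₂ u

theorem exists_mul_norm_le {N : Seminorm ℝ Plane} (hN : ∀ u, N u = 0 → u = 0) :
    ∃ κ > 0, ∀ u, κ * ‖u‖ ≤ N u := by
  have hne : (Metric.sphere (0 : Plane) 1).Nonempty := NormedSpace.sphere_nonempty.2 zero_le_one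
  obtain ⟨x, hx, hmin⟩ := (isCompact_sphere (0 : Plane) 1).exists_isMinOn hne
    (seminorm_plane_continuous N).continuousOn
  have hx1 : ‖x‖ = 1 := by simpa using hx
  have hx0 : 0 < N x := lt_of_le_of_ne (apply_nonneg N x) fun h => by
    have := hN x h.symm
    rw [this, norm_zero] at hx1
    exact zero_ne_one hx1
  refine ⟨N x, hx0, fun u => ?_⟩
  rcases eq_or_ne u 0 with rfl | hu
  · simp
  have hu' : 0 < ‖u‖ := norm_pos_iff.2 hu
  have h1 : N x ≤ N (‖u‖⁻¹ • u) := hmin (by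
    rw [mem_sphere_zero_iff_norm, norm_smul, norm_inv, norm_norm, inv_mul_cancel₀ hu'.ne'])
  rw [map_smul_eq_mul, norm_inv, norm_norm, ← div_eq_inv_mul, le_div_iff₀ hu'] at h1
  exact h1

theorem exists_isEllipsoidNormFor {N : Seminorm ℝ Plane} (hN : ∀ u, N u = 0 → u = 0) :
    ∃ a c D : ℝ, IsEllipsoidNormFor N a c D := by
  obtain ⟨κ, hκ, hκN⟩ := exists_mul_norm_le hN
  obtain ⟨b, hb⟩ : ∃ b : ℝ, b = N ![1, 0] ^ 2 + N ![0, 1] ^ 2 := ⟨_, rfl⟩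
  have hb0 : 0 ≤ b := by rw [hb]; positivity
  have hup : ∀ u, N u ^ 2 ≤ b * (u 0 ^ 2 + u 1 ^ 2) := by
    intro u
    have hu : u = u 0 • ![1, 0] + u 1 • ![0, 1] := by apply plane_ext <;> simp
    have h1 : N u ≤ |u 0| * N ![1, 0] + |u 1| * N ![0, 1] := by
      calc N u = N (u 0 • ![1, 0] + u 1 • ![0, 1]) := by rw [← hu]
        _ ≤ N (u 0 • ![1, 0]) + N (u 1 • ![0, 1]) := map_add_le_add N _ _
        _ = _ := by rw [map_smul_eq_mul, map_smul_eq_mul, Real.norm_eq_abs, Real.norm_eq_abs]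
    have h2 := pow_le_pow_left₀ (apply_nonneg N u) h1 2
    rw [← sq_abs (u 0), ← sq_abs (u 1), hb]
    nlinarith [sq_nonneg (|u 0| * N ![0, 1] - |u 1| * N ![1, 0])]
  obtain ⟨D, hD1, hD2⟩ : ∃ D : ℝ, 1 ≤ D ∧ 2 * b / κ ^ 2 ≤ D := ⟨_, le_max_left _ _, le_max_right _ _⟩
  have hDb : b ≤ D ^ 2 * (κ ^ 2 / 2) := by
    rw [div_le_iff₀ (by positivity)] at hD2
    have : D * κ ^ 2 ≤ D ^ 2 * κ ^ 2 := by gcongr; nlinarith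
    linarith
  refine ⟨κ ^ 2 / 2, κ ^ 2 / 2, D, isEllipsoidNormFor_of_sq (by positivity) (by positivity) hD1
    (fun u => ?_) fun u => ?_⟩
  · have h0 : u 0 ^ 2 ≤ ‖u‖ ^ 2 := sq_le_sq' (abs_le.1 (norm_le_pi_norm u 0)).1
      (abs_le.1 (norm_le_pi_norm u 0)).2
    have h1 : u 1 ^ 2 ≤ ‖u‖ ^ 2 := sq_le_sq' (abs_le.1 (norm_le_pi_norm u 1)).1
      (abs_le.1 (norm_le_pi_norm u 1)).2
    calc κ ^ 2 / 2 * u 0 ^ 2 + κ ^ 2 / 2 * u 1 ^ 2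
        ≤ κ ^ 2 / 2 * ‖u‖ ^ 2 + κ ^ 2 / 2 * ‖u‖ ^ 2 := by gcongr
      _ = (κ * ‖u‖) ^ 2 := by ring
      _ ≤ N u ^ 2 := by gcongr; exact hκN u
  · calc N u ^ 2 ≤ b * (u 0 ^ 2 + u 1 ^ 2) := hup u
      _ ≤ (D ^ 2 * (κ ^ 2 / 2)) * (u 0 ^ 2 + u 1 ^ 2) := by gcongr
      _ = _ := by ring

/-- The lower bound at the unit vectors bounds `a` and `c`; then large `D` makes the objective
smaller than a value already attained. The closed conditions allow `a = 0` or `c = 0`, but there the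
objective vanishes, so a maximiser has both positive. -/
theorem exists_isBestEllipsoidNormFor {N : Seminorm ℝ Plane} (hN : ∀ u, N u = 0 → u = 0) :
    ∃ a c D : ℝ, IsBestEllipsoidNormFor N a c D := by
  obtain ⟨a₀, c₀, D₀, h₀⟩ := exists_isEllipsoidNormFor hN
  let f : ℝ × ℝ × ℝ → ℝ := fun x => 4 * x.1 * x.2.1 / (4 * x.2.2 ^ 2 - 1)
  obtain ⟨F, hF⟩ : ∃ F, F = f (a₀, c₀, D₀) := ⟨_, rfl⟩
  have hF0 : 0 < F := by
    have h1 := h₀.a_pos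
    have h2 := h₀.c_pos
    have h3 : 0 < 4 * D₀ ^ 2 - 1 := by nlinarith [h₀.one_le]
    rw [hF]
    positivity
  obtain ⟨P, hP⟩ : ∃ P, P = N ![1, 0] ^ 2 := ⟨_, rfl⟩
  obtain ⟨Q, hQ⟩ : ∃ Q, Q = N ![0, 1] ^ 2 := ⟨_, rfl⟩
  have haP : ∀ a c D, IsEllipsoidNormFor N a c D → a ≤ P := fun a c D h => by
    simpa [hP] using h.sq_lower ![1, 0]
  have hcQ : ∀ a c D, IsEllipsoidNormFor N a c D → c ≤ Q := fun a c D h => by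
    simpa [hQ] using h.sq_lower ![0, 1]
  have hP0 : 0 ≤ P := by rw [hP]; positivity
  have hQ0 : 0 ≤ Q := by rw [hQ]; positivity
  let R : ℝ := 1 + 4 * P * Q / F
  have hR : ∀ a c D, IsEllipsoidNormFor N a c D → F ≤ f (a, c, D) → D ≤ R := by
    intro a c D h hf
    by_contra! hD
    have hD' : 4 * P * Q / F < D - 1 := by simp only [R] at hD; linarith
    have h1 := h.one_le
    have h2 : 0 < 4 * D ^ 2 - 1 := by nlinarith
    rw [div_lt_iff₀ hF0] at hD'
    rw [le_div_iff₀ h2] at hf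
    have h3 : 4 * a * c ≤ 4 * P * Q := by
      have := h.a_pos
      have := h.c_pos
      gcongr
      · exact haP _ _ _ h
      · exact hcQ _ _ _ h
    simp only at hf
    have h4 : (D - 1) * F ≤ (4 * D ^ 2 - 1) * F := by gcongr; nlinarith
    linarith
  let V : Set (ℝ × ℝ × ℝ) := (Set.Icc 0 P ×ˢ Set.Icc 0 Q ×ˢ Set.Icc 1 R) ∩
    {x | ∀ u, ellipsoidNorm x.1 x.2.1 u ≤ N u ∧ N u ≤ x.2.2 * ellipsoidNorm x.1 x.2.1 u}
  have hV : IsCompact V := by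
    refine (isCompact_Icc.prod (isCompact_Icc.prod isCompact_Icc)).inter_right ?_
    rw [Set.ofPred_forall]
    refine isClosed_iInter fun u => ?_
    unfold ellipsoidNorm
    have h1 : Continuous fun x : ℝ × ℝ × ℝ => √(x.1 * u 0 ^ 2 + x.2.1 * u 1 ^ 2) := by fun_prop
    exact (isClosed_le h1 continuous_const).inter
      (isClosed_le continuous_const (continuous_snd.snd.mul h1))
  have hmem : ∀ a c D, IsEllipsoidNormFor N a c D → F ≤ f (a, c, D) → (a, c, D) ∈ V :=
    fun a c D h hf => ⟨⟨⟨h.a_pos.le, haP _ _ _ h⟩, ⟨h.c_pos.le, hcQ _ _ _ h⟩,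
      ⟨h.one_le, hR _ _ _ h hf⟩⟩, fun u => ⟨h.lower u, h.upper u⟩⟩
  have hfc : ContinuousOn f V := by
    refine ContinuousOn.div (by fun_prop) (by fun_prop) ?_
    rintro x ⟨⟨-, -, hx⟩, -⟩
    nlinarith [hx.1]
  have h₀V := hmem _ _ _ h₀ hF.le
  obtain ⟨⟨a, c, D⟩, hx, hmax⟩ := hV.exists_isMaxOn ⟨_, h₀V⟩ hfc
  obtain ⟨⟨⟨ha, -⟩, ⟨hc, -⟩, ⟨hD, -⟩⟩, hE⟩ := hx
  simp only at ha hc hD hE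
  have hFm : F ≤ f (a, c, D) := hF ▸ hmax h₀V
  have hac : 0 < a * c := by
    have h2 : 0 < 4 * D ^ 2 - 1 := by nlinarith
    have h3 := hF0.trans_le hFm
    have h4 : 0 < 4 * a * c := (div_pos_iff_of_pos_right h2).1 h3
    linarith
  have ha' : 0 < a := pos_of_mul_pos_left hac hc
  have hc' : 0 < c := pos_of_mul_pos_right hac ha
  refine ⟨a, c, D, ⟨⟨ha', hc', hD, fun u => (hE u).1, fun u => (hE u).2⟩, fun a' c' D' h => ?_⟩⟩
  refine ellipsoidConst_le h.a_pos.le h.c_pos.le h.one_le ?_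
  rcases le_total F (f (a', c', D')) with h1 | h1
  · exact hmax (hmem _ _ _ h h1)
  · exact h1.trans hFm

/-! ### The `p`-norms -/

/-- For a competitor, the upper bounds at the unit vectors give `D'² a ≥ 1` and `D'² c ≥ 1`, while
the lower bound at `(1,1)` gives `a + c ≤ 2 t`. Hence `D'² ≥ D²`, and `a c ≤ t²` by the
arithmetic-geometric mean inequality. -/
theorem isBestEllipsoidNormFor_of_diag_le {N : Seminorm ℝ Plane} {t D : ℝ}
    (h : IsEllipsoidNormFor N t t D) (hD : D ^ 2 * t = 1) (h₀ : 1 ≤ N ![1, 0] ^ 2)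
    (h₁ : 1 ≤ N ![0, 1] ^ 2) (h₂ : N ![1, 1] ^ 2 ≤ 2 * t) : IsBestEllipsoidNormFor N t t D := by
  refine ⟨h, fun a c D' h' => ellipsoidConst_le h'.a_pos.le h'.c_pos.le h'.one_le ?_⟩
  have e0 := h₀.trans (h'.sq_upper _)
  have e1 := h₁.trans (h'.sq_upper _)
  have e2 := (h'.sq_lower _).trans h₂
  simp only [Matrix.cons_val_zero, Matrix.cons_val_one, Matrix.cons_val_fin_one] at e0 e1 e2
  have ha := h'.a_pos
  have hc := h'.c_pos
  have ht := h.a_pos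
  have hDD : D ^ 2 ≤ D' ^ 2 := by
    refine le_of_mul_le_mul_right ?_ ht
    nlinarith [mul_le_mul_of_nonneg_left e2 (sq_nonneg D')]
  have hpos : 0 < 4 * D ^ 2 - 1 := by nlinarith [h.one_le]
  refine div_le_div₀ (by positivity) ?_ hpos (by linarith)
  nlinarith [sq_nonneg (a - c)]

/-- Here the unit vectors bound `a` and `c` by `1`, and the upper bound at `(1,1)` then forces `D' ≥
D`. -/
theorem isBestEllipsoidNormFor_of_le_diag {N : Seminorm ℝ Plane} {D : ℝ}
    (h : IsEllipsoidNormFor N 1 1 D) (h₀ : N ![1, 0] ^ 2 ≤ 1)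
    (h₁ : N ![0, 1] ^ 2 ≤ 1) (h₂ : 2 * D ^ 2 ≤ N ![1, 1] ^ 2) :
    IsBestEllipsoidNormFor N 1 1 D := by
  refine ⟨h, fun a c D' h' => ellipsoidConst_le h'.a_pos.le h'.c_pos.le h'.one_le ?_⟩
  have e0 := (h'.sq_lower _).trans h₀
  have e1 := (h'.sq_lower _).trans h₁
  have e2 := h₂.trans (h'.sq_upper _)
  simp only [Matrix.cons_val_zero, Matrix.cons_val_one, Matrix.cons_val_fin_one] at e0 e1 e2
  have ha := h'.a_pos
  have hc := h'.c_pos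
  have hDD : D ^ 2 ≤ D' ^ 2 := by
    nlinarith [mul_le_mul_of_nonneg_left (by linarith : a + c ≤ 2) (sq_nonneg D')]
  have hpos : 0 < 4 * D ^ 2 - 1 := by nlinarith [h.one_le]
  refine div_le_div₀ (by positivity) ?_ hpos (by linarith)
  nlinarith

theorem Real.rpow_add_rpow_le_add_rpow {x y s : ℝ} (hx : 0 ≤ x) (hy : 0 ≤ y) (hs : 1 ≤ s) :
    x ^ s + y ^ s ≤ (x + y) ^ s := by
  lift x to NNReal using hx
  lift y to NNReal using hy
  exact_mod_cast NNReal.add_rpow_le_rpow_add x y hs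

theorem Real.add_rpow_le_mul_rpow_add_rpow {x y s : ℝ} (hx : 0 ≤ x) (hy : 0 ≤ y) (hs : 1 ≤ s) :
    (x + y) ^ s ≤ 2 ^ (s - 1) * (x ^ s + y ^ s) := by
  lift x to NNReal using hx
  lift y to NNReal using hy
  exact_mod_cast NNReal.rpow_add_le_mul_rpow_add_rpow x y hs

theorem pNorm_two_sq (u : Plane) : pNorm 2 u ^ 2 = u 0 ^ 2 + u 1 ^ 2 := by
  change ‖WithLp.toLp 2 u‖ ^ 2 = _
  rw [EuclideanSpace.norm_sq_eq]
  simp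

theorem pNorm_top (u : Plane) : pNorm ∞ u = max |u 0| |u 1| := by
  change ‖WithLp.toLp ∞ u‖ = _
  rw [PiLp.norm_toLp]
  apply le_antisymm
  · rw [pi_norm_le_iff_of_nonneg (by positivity)]
    intro j
    fin_cases j <;> simp
  · exact max_le (norm_le_pi_norm u 0) (norm_le_pi_norm u 1)

theorem pNorm_ofReal_sq {p : ℝ} [Fact (1 ≤ ENNReal.ofReal p)] (hp : 0 < p) (u : Plane) :
    pNorm (ENNReal.ofReal p) u ^ 2
      = ((u 0 ^ 2) ^ (p / 2) + (u 1 ^ 2) ^ (p / 2)) ^ (2 / p) := by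
  have ht : (ENNReal.ofReal p).toReal = p := ENNReal.toReal_ofReal hp.le
  change ‖WithLp.toLp (ENNReal.ofReal p) u‖ ^ 2 = _
  rw [PiLp.norm_eq_sum (by rwa [ht]), ht, Fin.sum_univ_two]
  have e : ∀ x : ℝ, ‖x‖ ^ p = (x ^ 2) ^ (p / 2) := by
    intro x
    rw [Real.norm_eq_abs, ← sq_abs, ← Real.rpow_natCast, ← Real.rpow_mul (abs_nonneg x)]
    congr 1
    push_cast
    ring
  rw [e, e, ← Real.rpow_natCast, ← Real.rpow_mul (by positivity)]
  congr 1
  push_cast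
  ring

theorem isBestEllipsoidNormFor_pNorm_two : IsBestEllipsoidNormFor (pNorm 2) 1 1 1 := by
  refine isBestEllipsoidNormFor_of_le_diag (isEllipsoidNormFor_of_sq one_pos one_pos le_rfl
    (fun u => ?_) fun u => ?_) ?_ ?_ ?_ <;> (rw [pNorm_two_sq]; simp; try norm_num)

theorem isBestEllipsoidNormFor_pNorm_top :
    IsBestEllipsoidNormFor (pNorm ∞) (1 / 2) (1 / 2) (√2) := by
  have hmax : ∀ u : Plane, u 0 ^ 2 ≤ pNorm ∞ u ^ 2 ∧ u 1 ^ 2 ≤ pNorm ∞ u ^ 2 := by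
    intro u
    rw [pNorm_top, ← sq_abs (u 0), ← sq_abs (u 1)]
    exact ⟨by gcongr; exact le_max_left _ _, by gcongr; exact le_max_right _ _⟩
  refine isBestEllipsoidNormFor_of_diag_le (isEllipsoidNormFor_of_sq (by norm_num) (by norm_num)
    (by rw [Real.one_le_sqrt]; norm_num) (fun u => ?_) fun u => ?_) ?_ ?_ ?_ ?_
  · linarith [(hmax u).1, (hmax u).2]
  · rw [Real.sq_sqrt (by norm_num), pNorm_top]
    rcases max_choice |u 0| |u 1| with h | h <;> rw [h, sq_abs] <;>
      nlinarith [sq_nonneg (u 0), sq_nonneg (u 1)]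
  · rw [Real.sq_sqrt] <;> norm_num
  · simp [pNorm_top]
  · simp [pNorm_top]
  · simp [pNorm_top]

theorem isBestEllipsoidNormFor_pNorm_of_two_lt {p : ℝ} [Fact (1 ≤ ENNReal.ofReal p)] (hp : 2 < p) :
    IsBestEllipsoidNormFor (pNorm (ENNReal.ofReal p))
      (2 ^ (2 / p - 1)) (2 ^ (2 / p - 1)) (2 ^ (1 / 2 - 1 / p)) := by
  have hp0 : 0 < p := by linarith
  have hs : 1 ≤ p / 2 := by linarith
  have hinv : p / 2 * (2 / p) = 1 := by field_simp
  have hD2 : ((2 : ℝ) ^ (1 / 2 - 1 / p)) ^ 2 = 2 ^ (1 - 2 / p) := by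
    rw [← Real.rpow_natCast, ← Real.rpow_mul (by norm_num)]
    congr 1
    push_cast
    ring
  have hDt : ((2 : ℝ) ^ (1 / 2 - 1 / p)) ^ 2 * 2 ^ (2 / p - 1) = 1 := by
    rw [hD2, ← Real.rpow_add (by norm_num)]
    simp
  have hroot : ∀ x : ℝ, 0 ≤ x → (x ^ (p / 2)) ^ (2 / p) = x := fun x hx => by
    rw [← Real.rpow_mul hx, hinv, Real.rpow_one]
  refine isBestEllipsoidNormFor_of_diag_le (isEllipsoidNormFor_of_sq (by positivity) (by positivity)
    ?_ (fun u => ?_) fun u => ?_) hDt ?_ ?_ ?_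
  · apply Real.one_le_rpow (by norm_num)
    rw [sub_nonneg]
    exact one_div_le_one_div_of_le (by norm_num) hp.le
  · rw [pNorm_ofReal_sq hp0, ← mul_add]
    -- The power mean inequality with exponent `p / 2`, applied to the squares of the coordinates.
    have h1 := Real.add_rpow_le_mul_rpow_add_rpow (sq_nonneg (u 0)) (sq_nonneg (u 1)) hs
    have h2 := Real.rpow_le_rpow (by positivity) h1 (by positivity : 0 ≤ 2 / p)
    rw [hroot _ (by positivity), Real.mul_rpow (by positivity) (by positivity),
      ← Real.rpow_mul (by norm_num), show (p / 2 - 1) * (2 / p) = 1 - 2 / p by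
        rw [sub_mul, hinv, one_mul]] at h2
    calc _ ≤ (2 : ℝ) ^ (2 / p - 1) * (2 ^ (1 - 2 / p) *
            ((u 0 ^ 2) ^ (p / 2) + (u 1 ^ 2) ^ (p / 2)) ^ (2 / p)) := by gcongr
      _ = _ := by rw [← mul_assoc, ← hD2, mul_comm (_ ^ (_ : ℝ)) (_ ^ 2), hDt, one_mul]
  · rw [pNorm_ofReal_sq hp0, ← mul_add, ← mul_assoc, hDt, one_mul]
    have h1 := Real.rpow_add_rpow_le_add_rpow (sq_nonneg (u 0)) (sq_nonneg (u 1)) hs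
    have h2 := Real.rpow_le_rpow (by positivity) h1 (by positivity : 0 ≤ 2 / p)
    rwa [hroot _ (by positivity)] at h2
  · rw [pNorm_ofReal_sq hp0]
    simp [Real.zero_rpow (by positivity : p / 2 ≠ 0)]
  · rw [pNorm_ofReal_sq hp0]
    simp [Real.zero_rpow (by positivity : p / 2 ≠ 0)]
  · rw [pNorm_ofReal_sq hp0, Real.rpow_sub (by norm_num), Real.rpow_one]
    simp only [Matrix.cons_val_zero, Matrix.cons_val_one, Matrix.cons_val_fin_one, one_pow,
      Real.one_rpow]
    norm_num
    linarith

theorem isBestEllipsoidNormFor_pNorm_of_lt_two {p : ℝ} [Fact (1 ≤ ENNReal.ofReal p)] (hp1 : 1 ≤ p)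
    (hp : p < 2) :
    IsBestEllipsoidNormFor (pNorm (ENNReal.ofReal p)) 1 1 (2 ^ (1 / p - 1 / 2)) := by
  have hp0 : 0 < p := by linarith
  have hs : 1 ≤ 2 / p := by rw [le_div_iff₀ hp0]; linarith
  have hinv : p / 2 * (2 / p) = 1 := by field_simp
  have hD2 : ((2 : ℝ) ^ (1 / p - 1 / 2)) ^ 2 = 2 ^ (2 / p - 1) := by
    rw [← Real.rpow_natCast, ← Real.rpow_mul (by norm_num)]
    congr 1
    push_cast
    ring
  have hroot : ∀ x : ℝ, 0 ≤ x → (x ^ (p / 2)) ^ (2 / p) = x := fun x hx => by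
    rw [← Real.rpow_mul hx, hinv, Real.rpow_one]
  refine isBestEllipsoidNormFor_of_le_diag (isEllipsoidNormFor_of_sq one_pos one_pos
    ?_ (fun u => ?_) fun u => ?_) ?_ ?_ ?_
  · apply Real.one_le_rpow (by norm_num)
    rw [sub_nonneg]
    exact one_div_le_one_div_of_le hp0 hp.le
  · rw [pNorm_ofReal_sq hp0, one_mul, one_mul]
    -- For `p < 2` the exponent `p / 2` is below `1`, so superadditivity is used for `2 / p` on the
    -- `p`-th powers.
    have h1 := Real.rpow_add_rpow_le_add_rpow (by positivity : 0 ≤ (u 0 ^ 2) ^ (p / 2))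
      (by positivity : 0 ≤ (u 1 ^ 2) ^ (p / 2)) hs
    rwa [hroot _ (by positivity), hroot _ (by positivity)] at h1
  · rw [pNorm_ofReal_sq hp0, one_mul, one_mul, hD2]
    have h1 := Real.add_rpow_le_mul_rpow_add_rpow (by positivity : 0 ≤ (u 0 ^ 2) ^ (p / 2))
      (by positivity : 0 ≤ (u 1 ^ 2) ^ (p / 2)) hs
    rwa [hroot _ (by positivity), hroot _ (by positivity)] at h1
  · rw [pNorm_ofReal_sq hp0]
    simp [Real.zero_rpow (by positivity : p / 2 ≠ 0)]
  · rw [pNorm_ofReal_sq hp0]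
    simp [Real.zero_rpow (by positivity : p / 2 ≠ 0)]
  · rw [pNorm_ofReal_sq hp0, hD2, Real.rpow_sub (by norm_num), Real.rpow_one]
    simp only [Matrix.cons_val_zero, Matrix.cons_val_one, Matrix.cons_val_fin_one, one_pow,
      Real.one_rpow]
    norm_num
    linarith

theorem ellipsoidConst_one_one_one : ellipsoidConst 1 1 1 = √(2 / √3) := by
  have h : (2 / √3 : ℝ) = (4 / 3) ^ (1 / 2 : ℝ) := by
    rw [← Real.sqrt_eq_rpow, Real.sqrt_div (by norm_num), show (4 : ℝ) = 2 ^ 2 by norm_num,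
      Real.sqrt_sq (by norm_num)]
  rw [h, Real.sqrt_eq_rpow, ← Real.rpow_mul (by norm_num), ellipsoidConst]
  norm_num

theorem ellipsoidConst_max : ellipsoidConst (1 / 2) (1 / 2) (√2) = (7 : ℝ) ^ (-1 / 4 : ℝ) := by
  rw [ellipsoidConst, Real.sq_sqrt (by norm_num), neg_div, Real.rpow_neg (by norm_num),
    ← Real.inv_rpow (by norm_num)]
  norm_num

theorem ellipsoidConst_of_two_lt {p : ℝ} (hp : 2 < p) :
    ellipsoidConst (2 ^ (2 / p - 1)) (2 ^ (2 / p - 1)) (2 ^ (1 / 2 - 1 / p)) =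
      8 ^ (1 / (2 * p)) * (8 - 4 ^ (1 / p)) ^ (-1 / 4 : ℝ) := by
  have hp0 : 0 < p := by linarith
  -- In terms of `T` both sides are fourth roots of the same rational function, `T⁶ / (8 - T²)`.
  obtain ⟨T, hT⟩ : ∃ T : ℝ, T = 2 ^ (1 / p) := ⟨_, rfl⟩
  have hT0 : 0 < T := by rw [hT]; positivity
  have e1 : (2 : ℝ) ^ (2 / p - 1) = T ^ 2 / 2 := by
    rw [Real.rpow_sub (by norm_num), Real.rpow_one, hT, ← Real.rpow_natCast (2 ^ (1 / p)),
      ← Real.rpow_mul (by norm_num)]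
    congr 2
    push_cast
    ring
  have e2 : ((2 : ℝ) ^ (1 / 2 - 1 / p)) ^ 2 = 2 / T ^ 2 := by
    rw [Real.rpow_sub (by norm_num), div_pow, ← hT, ← Real.sqrt_eq_rpow,
      Real.sq_sqrt (by norm_num)]
  have e3 : (4 : ℝ) ^ (1 / p) = T ^ 2 := by
    rw [hT, show (4 : ℝ) = 2 ^ (2 : ℝ) by norm_num, ← Real.rpow_natCast (2 ^ (1 / p)),
      ← Real.rpow_mul (by norm_num), ← Real.rpow_mul (by norm_num)]
    congr 1
    push_cast
    ring
  have e4 : (8 : ℝ) ^ (1 / (2 * p)) = (T ^ 6) ^ (1 / 4 : ℝ) := by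
    rw [hT, show (8 : ℝ) = 2 ^ (3 : ℝ) by norm_num, ← Real.rpow_natCast (2 ^ (1 / p)),
      ← Real.rpow_mul (by norm_num), ← Real.rpow_mul (by positivity), ← Real.rpow_mul (by norm_num)]
    congr 1
    push_cast
    field_simp
    norm_num
  have hT2 : T ^ 2 ≤ 4 := by
    rw [← e3]
    calc (4 : ℝ) ^ (1 / p) ≤ 4 ^ (1 : ℝ) := by
          apply Real.rpow_le_rpow_of_exponent_le (by norm_num)
          rw [div_le_one hp0]; linarith
      _ = 4 := Real.rpow_one 4
  have h8 : 0 < 8 - T ^ 2 := by linarith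
  rw [ellipsoidConst, e1, e2, e3, e4, neg_div, Real.rpow_neg h8.le, ← Real.inv_rpow h8.le,
    ← Real.mul_rpow (by positivity) (by positivity)]
  congr 1
  have : 4 * (2 / T ^ 2) - 1 = (8 - T ^ 2) / T ^ 2 := by field_simp; norm_num
  rw [this]
  field_simp
  norm_num

theorem ellipsoidConst_of_lt_two {p : ℝ} (hp : 0 < p) :
    ellipsoidConst 1 1 (2 ^ (1 / p - 1 / 2)) = √2 * (2 ^ (1 + 2 / p) - 1) ^ (-1 / 4 : ℝ) := by
  have e1 : 4 * ((2 : ℝ) ^ (1 / p - 1 / 2)) ^ 2 = 2 ^ (1 + 2 / p) := by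
    rw [show (4 : ℝ) = 2 ^ (2 : ℝ) by norm_num, ← Real.rpow_natCast _ 2,
      ← Real.rpow_mul (by norm_num), ← Real.rpow_add (by norm_num)]
    congr 1
    push_cast
    ring
  have e2 : 0 < (2 : ℝ) ^ (1 + 2 / p) - 1 := by
    rw [sub_pos]
    exact Real.one_lt_rpow (by norm_num) (by positivity)
  have e3 : √2 = (4 : ℝ) ^ (1 / 4 : ℝ) := by
    rw [Real.sqrt_eq_rpow, show (4 : ℝ) = 2 ^ (2 : ℝ) by norm_num, ← Real.rpow_mul (by norm_num)]
    norm_num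
  rw [ellipsoidConst, e1, e3, neg_div, Real.rpow_neg e2.le, ← Real.inv_rpow e2.le,
    ← Real.mul_rpow (by positivity) (by positivity)]
  congr 1
  ring

end

theorem theorem1 :
    (∀ N : Seminorm ℝ Plane, (∀ u, N u = 0 → u = 0) →
      ∃ M : ℝ, 0 < M ∧
        (∃ a c D : ℝ, IsBestEllipsoidNormFor N a c D) ∧
        (∀ a c D : ℝ, IsBestEllipsoidNormFor N a c D → M = ellipsoidConst a c D) ∧
        ∀ θ δ : ℝ, 0 ≤ θ → θ < 2 * Real.pi → 0 < δ →
        ∀ l r : ℕ → ℝ, (∀ n, l n < r n) → (∀ n, Set.Icc (l n) (r n) ⊆ Set.Icc 0 M) →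
        ∀ (m : ℕ) (z : ℤ → ℤ), 0 < m → AdmissibleResidues m z →
        #{v : Plane |
            (∃ q p, IsBestApproxSeq N v q p) ∧
            ¬ BadlyApproximable N v ∧
            ∀ q p, IsBestApproxSeq N v q p →
              (∀ n, N (longDisplacement v q p n) ∈ Set.Icc (l n) (r n)) ∧
              (∀ n, longDisplacement v q p n ∈ sector θ δ) ∧
              (∀ n, OppositeQuadrants (longDisplacement v q p n)
                (longDisplacement v q p (n + 1))) ∧
              (∀ n : ℕ, 1 ≤ n → (q n : ℤ) ≡ z n [ZMOD m]) ∧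
              (∀ n, 2 ≤ n → ∃ b : Module.Basis (Fin 3) ℤ (Fin 3 → ℤ),
                ⇑b = ![approxVector (q (n - 2)) (p (n - 2)),
                  approxVector (q (n - 1)) (p (n - 1)), approxVector (q n) (p n)])} = 𝔠) ∧
    (IsBestEllipsoidNormFor (pNorm 2) 1 1 1 ∧
      ellipsoidConst 1 1 1 = Real.sqrt (2 / Real.sqrt 3)) ∧
    (IsBestEllipsoidNormFor (pNorm ∞) (1 / 2) (1 / 2) (Real.sqrt 2) ∧
      ellipsoidConst (1 / 2) (1 / 2) (Real.sqrt 2) = (7 : ℝ) ^ (-1 / 4 : ℝ)) ∧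
    (∀ (p : ℝ) [Fact (1 ≤ ENNReal.ofReal p)], 2 < p →
      IsBestEllipsoidNormFor (pNorm (ENNReal.ofReal p))
        (2 ^ (2 / p - 1)) (2 ^ (2 / p - 1)) (2 ^ (1 / 2 - 1 / p)) ∧
      ellipsoidConst (2 ^ (2 / p - 1)) (2 ^ (2 / p - 1)) (2 ^ (1 / 2 - 1 / p)) =
        8 ^ (1 / (2 * p)) * (8 - 4 ^ (1 / p)) ^ (-1 / 4 : ℝ)) ∧
    (∀ (p : ℝ) [Fact (1 ≤ ENNReal.ofReal p)], 1 ≤ p → p < 2 →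
      IsBestEllipsoidNormFor (pNorm (ENNReal.ofReal p)) 1 1 (2 ^ (1 / p - 1 / 2)) ∧
      ellipsoidConst 1 1 (2 ^ (1 / p - 1 / 2)) =
        Real.sqrt 2 * (2 ^ (1 + 2 / p) - 1) ^ (-1 / 4 : ℝ)) := by
  refine ⟨fun N hN => ?_, ⟨isBestEllipsoidNormFor_pNorm_two, ellipsoidConst_one_one_one⟩,
    ⟨isBestEllipsoidNormFor_pNorm_top, ellipsoidConst_max⟩,
    fun p _ hp => ⟨isBestEllipsoidNormFor_pNorm_of_two_lt hp, ellipsoidConst_of_two_lt hp⟩,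
    fun p _ hp₁ hp => ⟨isBestEllipsoidNormFor_pNorm_of_lt_two hp₁ hp,
      ellipsoidConst_of_lt_two (by linarith)⟩⟩
  obtain ⟨a, c, D, h⟩ := exists_isBestEllipsoidNormFor hN
  have ha := h.a_pos
  have hc := h.c_pos
  have hD : 0 < 4 * D ^ 2 - 1 := by nlinarith [h.one_le]
  -- `D ≥ 1` gives `4 D² - 1 ≥ 3`, the only way `D` enters the construction.
  have hM : 3 * ellipsoidConst a c D ^ 4 ≤ 4 * (a * c) := by
    rw [ellipsoidConst_pow_four ha.le hc.le h.one_le, ← mul_div_assoc, div_le_iff₀ hD]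
    have h₁ : 3 ≤ 4 * D ^ 2 - 1 := by nlinarith [h.one_le]
    have h₂ : 0 < a * c := mul_pos ha hc
    nlinarith
  refine ⟨ellipsoidConst a c D, Real.rpow_pos_of_pos (by positivity) _, ⟨a, c, D, h⟩,
    fun a' c' D' h' => le_antisymm (h'.maximal _ _ _ h.toIsEllipsoidNormFor)
      (h.maximal _ _ _ h'.toIsEllipsoidNormFor), ?_⟩
  intro θ δ _ _ hδ l r hlr hI m z hm hz
  exact card_prescribed_eq_continuum N ha hc h.sq_lower hM θ hδ hlr hI hm hz
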